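/- Let $T\ge 2$ and $c\in(0,1]$. A \emph{$c$-smoothed setting} $\mathcal P$ assigns to every outcome history $(x_1,\dots,x_{t-1})\in\{0,1\}^{t-1}$, $1\le t\le T$, a probability distribution $\mathcal P(x_1,\dots,x_{t-1})$ on $[0,1]$ that has a density bounded by $1/c$ everywhere. For $t=1,\dots,T$, one draws $p^\star_t\sim\mathcal P(x_1,\dots,x_{t-1})$, reveals $p^\star_t$ to the forecaster, who outputs a prediction $p_t=\mathcal A(x_1,\dots,x_{t-1},p^\star_t)\in[0,1]$, and then draws $x_t\sim\mathrm{Bern}(p^\star_t)$. The truthful forecaster $\mathcal A^{\mathsf{truthful}}$ predicts $p_t=p^\star_t$. For $x\in\{0,1\}^T$ and $p\in[0,1]^T$ put $$\mathsf{StepCE}^{\mathsf{sub}}(x,p)=\mathbb E_{S\sim\mathsf{Unif}(2^{[T]})}\Big[\sup_{\alpha\in[0,1]}\Big|\sum_{t=1}^T(x_t-p_t)\cdot\mathbf 1[p_t\le\alpha\wedge t\in S]\Big|\Big].$$ Let $\mathsf{err}(\mathcal P,\mathcal A)=\mathbb E[\mathsf{StepCE}^{\mathsf{sub}}(x,p)]$,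 let $\mathsf{OPT}(\mathcal P)=\inf_{\mathcal A}\mathsf{err}(\mathcal P,\mathcal A)$ over all (measurable, deterministic) forecasters, and let $\mathrm{Var}_T=\sum_{t=1}^Tp^\star_t(1-p^\star_t)$. \textbf{Theorem.} For every $T\ge 2$, every $c\in(0,1]$ and every $c$-smoothed setting $\mathcal P$: (1) $\mathsf{err}(\mathcal P,\mathcal A^{\mathsf{truthful}})$ is at most $$\left(547\sqrt{\ln(1/c)}+1161\right)\mathbb E\big[\sqrt{\mathrm{Var}_T}\big]+(\log_2T+3)\left[16\log_2(T)\log_2(T/c)+15\right]+8\sqrt{2\ln(1/c)}+17\sqrt2 .$$ (2) Consequently, there is a universal constant $C>0$ (independent of $T$, $c$ and $\mathcal P$) such that $$\mathsf{err}(\mathcal P,\mathcal A^{\mathsf{truthful}})\le C\left(\sqrt{\log(1/c)}+1\right)\mathbb E\big[\sqrt{\mathrm{Var}_T}\big]+C\log^2(T)\log(T/c).$$ (3) $\mathsf{StepCE}^{\mathsf{sub}}$ is $\big(O(\sqrt{\log(1/c)}+1),\operatorname{polylog}(T/c)\big)$-truthful in $c$-smoothed settings: there are universal constants $C>0$ and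 $k\in\mathbb N$ such that $$\mathsf{err}(\mathcal P,\mathcal A^{\mathsf{truthful}})\le C\left(\sqrt{\log(1/c)}+1\right)\mathsf{OPT}(\mathcal P)+C\log^k(T/c).$$ -/

import Mathlib

open MeasureTheory ProbabilityTheory
open scoped unitInterval ENNReal

namespace StepCalibration

noncomputable section

/-- The numerical value of a binary outcome. -/
def bit (b : Bool) : ℝ := if b then 1 else 0

/-! ### Step calibration error -/

/-- Step calibration error restricted to the time steps in `S`:
`sup_{α ∈ [0,1]} |∑_t (x_t - p_t) 1[p_t ≤ α and t ∈ S]|`. -/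
def stepCEOn {T : ℕ} (S : Finset (Fin T)) (x : Fin T → Bool) (p : Fin T → I) : ℝ :=
  ⨆ α : I, |∑ t, (bit (x t) - (p t : ℝ)) * (if p t ≤ α ∧ t ∈ S then 1 else 0)|

/-- Subsampled step calibration error: the expectation of the step calibration error on `S`,
where `S` is uniform over all `2 ^ T` subsets of the time steps. -/
def stepCEsub {T : ℕ} (x : Fin T → Bool) (p : Fin T → I) : ℝ :=
  (∑ S : Finset (Fin T), stepCEOn S x p) / 2 ^ T

/-! ### The smoothed prediction setting -/

/-- Nature maps every outcome history to a distribution over `[0, 1]`, from which the next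
conditional probability is drawn. For horizon `T` only histories of length `< T` are used. -/
abbrev Nature := (n : ℕ) → (Fin n → Bool) → ProbabilityMeasure I

/-- `μ` is a distribution over `[0, 1]` having a density bounded by `1 / c` everywhere. -/
def HasBoundedDensity (c : ℝ) (μ : Measure I) : Prop :=
  ∃ f : I → ℝ≥0∞, Measurable f ∧ (∀ u, f u ≤ ENNReal.ofReal (1 / c)) ∧
    μ = (volume : Measure I).withDensity f

/-- Nature is `c`-smoothed over the horizon `T`. -/
def IsSmoothed (T : ℕ) (c : ℝ) (P : Nature) : Prop :=
  ∀ n, n < T → ∀ h : Fin n → Bool, HasBoundedDensity c (P n h : Measure I)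

/-- A transcript of `n` rounds: the pairs `(x_t, p*_t)`. -/
abbrev Transcript (n : ℕ) := Fin n → Bool × I

/-- The outcome sequence of a transcript. -/
def outcomes {n : ℕ} (ω : Transcript n) : Fin n → Bool := fun t => (ω t).1

/-- The sequence of conditional probabilities of a transcript. -/
def condProbs {n : ℕ} (ω : Transcript n) : Fin n → I := fun t => (ω t).2

/-- One round: draw `p` from `μ`, then `b ∼ Bern(p)`, and return `(b, p)`. -/
def roundLaw (μ : Measure I) : Measure (Bool × I) :=
  μ.bind fun p => (bernoulliMeasure true false p).map fun b => (b, p)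

/-- The joint law of the first `n` rounds: given the transcript of the preceding rounds, round
`n` is played with the distribution that nature assigns to the preceding outcomes. -/
def law (P : Nature) : (n : ℕ) → Measure (Transcript n)
  | 0 => Measure.dirac fun i => i.elim0
  | n + 1 => (law P n).bind fun h =>
      (roundLaw (P n (outcomes h) : Measure I)).map
        fun z => Fin.snoc (α := fun _ => Bool × I) h z

/-- A (deterministic) forecaster: its prediction is a function of the preceding outcomes and of
the revealed conditional probability of the current outcome. -/
structure Forecaster where
  predict : (n : ℕ) → (Fin n → Bool) → I → I
  measurable_predict : ∀ n h, Measurable (predict n h)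

/-- The truthful forecaster predicts the revealed conditional probability. -/
def truthful : Forecaster where
  predict _ _ p := p
  measurable_predict _ _ := measurable_id

/-- The predictions that a forecaster makes along a transcript. -/
def Forecaster.predictions {T : ℕ} (A : Forecaster) (ω : Transcript T) : Fin T → I :=
  fun t => A.predict t (fun s => outcomes ω (s.castLE t.isLt.le)) (condProbs ω t)

/-- The expected penalty of forecaster `A` against nature `P` over the horizon `T`, under the
calibration measure `CM`. -/
def err {T : ℕ} (CM : (Fin T → Bool) → (Fin T → I) → ℝ) (P : Nature) (A : Forecaster) : ℝ :=
  ∫ ω, CM (outcomes ω) (A.predictions ω) ∂(law P T)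

/-- The optimal expected penalty over all forecasters. -/
def OPT {T : ℕ} (CM : (Fin T → Bool) → (Fin T → I) → ℝ) (P : Nature) : ℝ :=
  ⨅ A : Forecaster, err CM P A

/-- `CM` is `(α, β)`-truthful in the `c`-smoothed setting with horizon `T`. -/
def IsTruthfulSmoothed {T : ℕ} (CM : (Fin T → Bool) → (Fin T → I) → ℝ) (c α β : ℝ) : Prop :=
  ∀ P : Nature, IsSmoothed T c P → err CM P truthful ≤ α * OPT CM P + β

/-- The realized variance `∑_t p*_t (1 - p*_t)`. -/
def realizedVar {T : ℕ} (ω : Transcript T) : ℝ :=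
  ∑ t, (condProbs ω t : ℝ) * (1 - (condProbs ω t : ℝ))

/-- `E[√Var_T]`, the expected square root of the realized variance over the horizon `T`. -/
def expSqrtVar (T : ℕ) (P : Nature) : ℝ :=
  ∫ ω, √(realizedVar ω) ∂(law P T)

/-! ### The laws are probability measures and the expectations above are genuine -/

lemma measurable_bernoulli_round :
    Measurable fun p : I => (bernoulliMeasure true false p).map fun b => (b, p) := by
  refine Measure.measurable_of_measurable_coe _ fun s hs => ?_
  have h : (fun p : I => ((bernoulliMeasure true false p).map fun b => (b, p)) s) =
      fun p : I => (unitInterval.toNNReal p : ℝ≥0∞) * s.indicator 1 (true, p) +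
        (unitInterval.toNNReal (unitInterval.symm p) : ℝ≥0∞) * s.indicator 1 (false, p) := by
    funext p
    have hpre : MeasurableSet ((fun b : Bool => (b, p)) ⁻¹' s) := MeasurableSet.of_discrete
    rw [Measure.map_apply (by fun_prop) hs, bernoulliMeasure_def, Measure.add_apply,
      Measure.smul_apply, Measure.smul_apply, Measure.dirac_apply' _ hpre,
      Measure.dirac_apply' _ hpre]
    rfl
  rw [h]
  have h1 : Measurable fun p : I => (unitInterval.toNNReal p : ℝ≥0∞) := by
    have : Continuous unitInterval.toNNReal := by fun_prop
    exact this.measurable.coe_nnreal_ennreal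
  have h2 (b : Bool) : Measurable fun p : I => s.indicator (1 : Bool × I → ℝ≥0∞) (b, p) :=
    (measurable_one.indicator hs).comp (by fun_prop)
  exact (h1.mul (h2 _)).add ((h1.comp (by fun_prop)).mul (h2 _))

instance (μ : Measure I) [IsProbabilityMeasure μ] : IsProbabilityMeasure (roundLaw μ) := by
  unfold roundLaw
  refine isProbabilityMeasure_bind measurable_bernoulli_round.aemeasurable ?_
  exact Filter.Eventually.of_forall fun p => Measure.isProbabilityMeasure_map (by fun_prop)

lemma measurable_outcomes {n : ℕ} : Measurable (outcomes (n := n)) := by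
  unfold outcomes; fun_prop

lemma measurable_condProbs {n : ℕ} : Measurable (condProbs (n := n)) := by
  unfold condProbs; fun_prop

lemma measurable_law_step (P : Nature) (n : ℕ) :
    Measurable fun h : Transcript n => (roundLaw (P n (outcomes h) : Measure I)).map
      fun z => Fin.snoc (α := fun _ => Bool × I) h z := by
  let κ : Kernel (Transcript n) (Bool × I) :=
    ⟨fun h => roundLaw (P n (outcomes h) : Measure I),
      (Measurable.of_discrete (f := fun x : Fin n → Bool =>
        roundLaw (P n x : Measure I))).comp measurable_outcomes⟩
  have : IsMarkovKernel κ := ⟨fun h => by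
    change IsProbabilityMeasure (roundLaw _); infer_instance⟩
  have hm : Measurable fun q : Transcript n × (Bool × I) =>
      (Fin.snoc (α := fun _ => Bool × I) q.1 q.2 : Transcript (n + 1)) := by
    refine measurable_pi_lambda _ fun i => ?_
    refine Fin.lastCases ?_ (fun j => ?_) i
    · simpa using measurable_snd
    · simp only [Fin.snoc_castSucc]
      exact (measurable_pi_apply j).comp measurable_fst
  refine Measure.measurable_of_measurable_coe _ fun s hs => ?_
  have := Kernel.measurable_kernel_prodMk_left (κ := κ) (hm hs)
  convert this using 2 with h
  exact Measure.map_apply (hm.comp measurable_prodMk_left) hs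

instance (P : Nature) (n : ℕ) : IsProbabilityMeasure (law P n) := by
  induction n with
  | zero => unfold law; infer_instance
  | succ n ih =>
    unfold law
    refine isProbabilityMeasure_bind (measurable_law_step P n).aemeasurable ?_
    refine Filter.Eventually.of_forall fun h => Measure.isProbabilityMeasure_map ?_
    refine Measurable.aemeasurable (measurable_pi_lambda _ fun i => ?_)
    refine Fin.lastCases ?_ (fun j => ?_) i
    · simp only [Fin.snoc_last]
      exact measurable_id
    · simp

lemma measurable_predictions {T : ℕ} (A : Forecaster) :
    Measurable fun ω : Transcript T => A.predictions ω := by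
  refine measurable_pi_lambda _ fun t => ?_
  have h : Measurable fun q : (Fin t → Bool) × I => A.predict t q.1 q.2 :=
    measurable_from_prod_countable_right fun x => A.measurable_predict t x
  unfold Forecaster.predictions
  refine h.comp (Measurable.prodMk ?_ ?_)
  · exact measurable_pi_lambda _ fun s => (measurable_pi_apply _).comp measurable_outcomes
  · exact (measurable_pi_apply t).comp measurable_condProbs

lemma abs_bit_sub_le (b : Bool) (p : I) : |bit b - (p : ℝ)| ≤ 1 := by
  have h0 := p.2.1
  have h1 := p.2.2
  cases b <;> simp only [bit, abs_le] <;> constructor <;> norm_num <;> linarith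

lemma abs_stepSum_le {T : ℕ} (S : Finset (Fin T)) (x : Fin T → Bool) (p : Fin T → I) (α : I) :
    |∑ t, (bit (x t) - (p t : ℝ)) * (if p t ≤ α ∧ t ∈ S then 1 else 0)| ≤ T := by
  refine (Finset.abs_sum_le_sum_abs _ _).trans ?_
  refine (Finset.sum_le_sum (g := fun _ => (1 : ℝ)) fun t _ => ?_).trans (by simp)
  have := abs_bit_sub_le (x t) (p t)
  split_ifs <;> simp [this]

lemma stepCEOn_nonneg {T : ℕ} (S : Finset (Fin T)) (x : Fin T → Bool) (p : Fin T → I) :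
    0 ≤ stepCEOn S x p :=
  Real.iSup_nonneg fun _ => abs_nonneg _

lemma stepCEOn_le {T : ℕ} (S : Finset (Fin T)) (x : Fin T → Bool) (p : Fin T → I) :
    stepCEOn S x p ≤ T :=
  ciSup_le fun α => abs_stepSum_le S x p α

/-- The supremum is attained at one of the predictions, or vanishes. -/
lemma stepCEOn_eq_max {T : ℕ} (S : Finset (Fin T)) (x : Fin T → Bool) (p : Fin T → I) :
    stepCEOn S x p = max 0 (⨆ s : Fin T,
      |∑ t, (bit (x t) - (p t : ℝ)) * (if p t ≤ p s ∧ t ∈ S then 1 else 0)|) := by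
  apply le_antisymm
  · refine ciSup_le fun α => ?_
    by_cases h : ∃ s, p s ≤ α
    · obtain ⟨s, hs, hmax⟩ := (Finset.univ.filter fun s => p s ≤ α).exists_max_image p
        (by obtain ⟨s, hs⟩ := h; exact ⟨s, by simpa using hs⟩)
      have hs' : p s ≤ α := by simpa using hs
      refine le_trans (le_of_eq ?_) ((le_ciSup (Set.finite_range _).bddAbove s).trans
        (le_max_right _ _))
      congr 1
      refine Finset.sum_congr rfl fun t _ => ?_
      have : p t ≤ α ↔ p t ≤ p s := ⟨fun ht => hmax t (by simpa using ht), fun ht => ht.trans hs'⟩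
      simp only [this]
    · push Not at h
      refine le_trans (le_of_eq ?_) (le_max_left _ _)
      rw [abs_eq_zero]
      exact Finset.sum_eq_zero fun t _ => by simp [not_le.2 (h t)]
  · refine max_le (stepCEOn_nonneg S x p) ?_
    refine Real.iSup_le (fun s => ?_) (stepCEOn_nonneg S x p)
    exact le_ciSup (f := fun α : I => |∑ t, (bit (x t) - (p t : ℝ)) *
      (if p t ≤ α ∧ t ∈ S then 1 else 0)|)
      ⟨T, by rintro _ ⟨α, rfl⟩; exact abs_stepSum_le S x p α⟩ (p s)

lemma measurable_stepCEOn {T : ℕ} (S : Finset (Fin T)) :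
    Measurable fun q : (Fin T → Bool) × (Fin T → I) => stepCEOn S q.1 q.2 := by
  simp only [stepCEOn_eq_max]
  refine measurable_const.max (Measurable.iSup fun s => ?_)
  refine Measurable.abs (Finset.measurable_sum _ fun t _ => Measurable.mul ?_ ?_)
  · exact ((Measurable.of_discrete (f := bit)).comp (by fun_prop)).sub (by fun_prop)
  · refine Measurable.ite ?_ measurable_const measurable_const
    exact (measurableSet_le (by fun_prop) (by fun_prop)).inter (MeasurableSet.const _)

/-- The penalty of every forecaster is integrable, so that `err stepCEsub` is an expectation. -/
lemma integrable_stepCEsub {T : ℕ} (P : Nature) (A : Forecaster) :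
    Integrable (fun ω : Transcript T => stepCEsub (outcomes ω) (A.predictions ω)) (law P T) := by
  unfold stepCEsub
  refine Integrable.div_const (integrable_finsetSum _ fun S _ => ?_) _
  refine Integrable.of_bound (C := (T : ℝ)) ?_ ?_
  · exact ((measurable_stepCEOn S).comp
      (measurable_outcomes.prodMk (measurable_predictions A))).aestronglyMeasurable
  · refine Filter.Eventually.of_forall fun ω => ?_
    rw [Real.norm_of_nonneg (stepCEOn_nonneg _ _ _)]
    exact stepCEOn_le _ _ _

lemma integrable_sqrt_realizedVar (P : Nature) (T : ℕ) :
    Integrable (fun ω : Transcript T => √(realizedVar ω)) (law P T) := by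
  have hm : Measurable fun ω : Transcript T => realizedVar ω := by
    unfold realizedVar condProbs; fun_prop
  refine Integrable.of_bound (C := √(T : ℝ)) hm.sqrt.aestronglyMeasurable ?_
  refine Filter.Eventually.of_forall fun ω => ?_
  rw [Real.norm_of_nonneg (Real.sqrt_nonneg _)]
  refine Real.sqrt_le_sqrt ((Finset.sum_le_sum (g := fun _ => (1 : ℝ)) fun t _ => ?_).trans
    (by simp))
  nlinarith [(condProbs ω t).2.1, (condProbs ω t).2.2]

end

end StepCalibration

open MeasureTheory ProbabilityTheory
open scoped unitInterval ENNReal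

namespace StepCalibration

noncomputable section

/-! ### Exponential inequalities along a transcript -/

/-! Upper bound. Fix the set `S` of time steps. Under truthful prediction each term `x_t - p_t` is
centred given the past and `p_t`, so every threshold sum is a martingale with weights in `[-1, 1]`.
Randomness of `S` is not needed here: the bound holds for each `S` and is then averaged.

The rounds are split into epochs according to the realized variance accumulated before them, with
thresholds `0, 1, 4, 16, …`. Inside an epoch the supremum over `α` is controlled by dyadic chaining.
A union bound handles the thresholds on a grid of mesh `2⁻ᵏ` with `2ᵏ ≥ 4 / c²`, at cost about `√(hi
· k)`; this is the source of `√(log (1/c))`. At finer levels smoothness enters: the mean variance of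
a round is at least `c / 16` and an interval of length `r` has mass at most `r / c`, so a link of
length `2⁻⁽ᵏ⁺ⁱ⁾` carries at most the fraction `2⁻ⁱ` of the mean variance. The link costs therefore
decay geometrically. After about `log₂ T` levels a cell has expected count at most a constant, and
its maximal count is logarithmic (`exists_epoch_dominant`).

The tool is an exponential supermartingale compensated by the realized variance
(`lintegral_exp_round_le_one`), which within an epoch is at most `hi + 1 / 4`. As an epoch sum
vanishes unless the epoch is reached, `setIntegral_le_measureReal_mul_log` bounds its cost by the
probability of reaching the epoch. Since `2 ^ j` summed over the reached epochs is at most `1 +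
4√Var`, the leading terms add up to a multiple of `E √Var`, while the logarithmic terms are paid
once per epoch (`integral_stepCEOn_le`).

Lower bound on `OPT`. At `α = 1`, subsampling makes the error a random subset sum, which by a
Khintchine inequality is at least a constant times `√(∑ (x_t - p_t)²)`. No forecaster has expected
square loss below the Bernoulli variance, and an exponential supermartingale turns this into `E √Var
≤ 6 err + 2` (`expSqrtVar_le_err`). Truthfulness follows by combining the two bounds. -/

/-- The first `t` rounds of a transcript. -/
def pre {T : ℕ} (ω : Transcript T) (t : Fin T) : Transcript t := fun s => ω (s.castLE t.isLt.le)

lemma measurable_pre {T : ℕ} (t : Fin T) : Measurable fun ω : Transcript T => pre ω t :=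
  measurable_pi_lambda _ fun _ => measurable_pi_apply _

lemma measurable_snoc {n : ℕ} (h : Transcript n) :
    Measurable fun z : Bool × I => (Fin.snoc (α := fun _ => Bool × I) h z : Transcript (n + 1)) := by
  refine measurable_pi_lambda _ fun i => ?_
  refine Fin.lastCases ?_ (fun j => ?_) i
  · simp only [Fin.snoc_last]
    exact measurable_id
  · simp

lemma pre_snoc_castSucc {n : ℕ} (h : Transcript n) (z : Bool × I) (t : Fin n) :
    pre (Fin.snoc (α := fun _ => Bool × I) h z : Transcript (n + 1)) t.castSucc = pre h t := by
  funext s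
  exact Fin.snoc_castSucc (α := fun _ => Bool × I) z h (s.castLE t.isLt.le)

lemma pre_snoc_last {n : ℕ} (h : Transcript n) (z : Bool × I) :
    pre (Fin.snoc (α := fun _ => Bool × I) h z : Transcript (n + 1)) (Fin.last n) = h := by
  funext s
  exact Fin.snoc_castSucc (α := fun _ => Bool × I) z h s

lemma lintegral_roundLaw (μ : Measure I) {g : Bool × I → ℝ≥0∞} (hg : Measurable g) :
    ∫⁻ z, g z ∂roundLaw μ =
      ∫⁻ p : I, ENNReal.ofReal p * g (true, p) + ENNReal.ofReal (1 - p) * g (false, p) ∂μ := by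
  unfold roundLaw
  rw [Measure.lintegral_bind measurable_bernoulli_round.aemeasurable hg.aemeasurable]
  refine lintegral_congr fun p => ?_
  rw [lintegral_map hg (by fun_prop), bernoulliMeasure_def, lintegral_add_measure,
    lintegral_smul_measure, lintegral_smul_measure, lintegral_dirac, lintegral_dirac]
  congr 1
  · congr 2
    exact (Real.toNNReal_of_nonneg p.2.1).symm
  · congr 2
    exact (Real.toNNReal_of_nonneg (unitInterval.symm p).2.1).symm

lemma lintegral_law_succ (P : Nature) (n : ℕ) {g : Transcript (n + 1) → ℝ≥0∞} (hg : Measurable g) :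
    ∫⁻ ω, g ω ∂law P (n + 1) = ∫⁻ h, ∫⁻ z, g (Fin.snoc (α := fun _ => Bool × I) h z)
      ∂roundLaw (P n (outcomes h) : Measure I) ∂law P n := by
  rw [law, Measure.lintegral_bind (measurable_law_step P n).aemeasurable hg.aemeasurable]
  refine lintegral_congr fun h => ?_
  rw [lintegral_map hg (measurable_snoc h)]

/-- The exponentials of the partial sums form a supermartingale: integrating out the last round,
given the transcript before it, contributes a factor at most one. -/
lemma lintegral_exp_sum_le_one (P : Nature) (U : (n : ℕ) → Transcript n → Bool × I → ℝ)
    (hm : ∀ n, Measurable fun q : Transcript n × (Bool × I) => U n q.1 q.2) (T : ℕ)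
    (hU : ∀ n < T, ∀ h, ∫⁻ z, ENNReal.ofReal (Real.exp (U n h z))
      ∂roundLaw (P n (outcomes h) : Measure I) ≤ 1) :
    ∫⁻ ω, ENNReal.ofReal (Real.exp (∑ t : Fin T, U t (pre ω t) (ω t))) ∂law P T ≤ 1 := by
  have hmeas (T : ℕ) (t : Fin T) : Measurable fun ω : Transcript T => U t (pre ω t) (ω t) :=
    (hm t).comp ((measurable_pre t).prodMk (measurable_pi_apply t))
  induction T with
  | zero => simp
  | succ n ih =>
    rw [lintegral_law_succ]
    swap
    · exact (Real.measurable_exp.comp (Finset.measurable_sum _ fun t _ =>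
        hmeas (n + 1) t)).ennreal_ofReal
    refine le_trans (lintegral_mono fun h => ?_) (ih fun m hmn => hU m (by omega))
    simp only [Fin.sum_univ_castSucc, pre_snoc_last, pre_snoc_castSucc, Fin.snoc_last,
      Fin.snoc_castSucc, Real.exp_add]
    simp_rw [ENNReal.ofReal_mul (Real.exp_pos _).le]
    have hmz : Measurable fun z => ENNReal.ofReal (Real.exp (U n h z)) :=
      (Real.measurable_exp.comp ((hm n).comp measurable_prodMk_left)).ennreal_ofReal
    refine (lintegral_const_mul _ hmz).trans_le ?_
    exact mul_le_of_le_one_right' (hU n (by omega) h)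

lemma integrable_exp_of_lintegral_le_one {Ω : Type*} [MeasurableSpace Ω] {μ : Measure Ω}
    {U : Ω → ℝ} (hm : Measurable U) (hU : ∫⁻ ω, ENNReal.ofReal (Real.exp (U ω)) ∂μ ≤ 1) :
    Integrable (fun ω => Real.exp (U ω)) μ ∧ ∫ ω, Real.exp (U ω) ∂μ ≤ 1 := by
  have h0 : 0 ≤ᵐ[μ] fun ω => Real.exp (U ω) :=
    Filter.Eventually.of_forall fun _ => (Real.exp_pos _).le
  have hms := (Real.measurable_exp.comp hm).aestronglyMeasurable (μ := μ)
  refine ⟨⟨hms, ?_⟩, ?_⟩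
  · rw [hasFiniteIntegral_iff_ofReal h0]
    exact hU.trans_lt ENNReal.one_lt_top
  · rw [integral_eq_lintegral_of_nonneg_ae h0 hms]
    exact ENNReal.toReal_le_of_le_ofReal zero_le_one (by simpa using hU)

/-- A maximal inequality on an event: if each `U i` has exponential moment at most one and vanishes
off `B`, then the maximum of the `U i` costs at most `log` of their number, relative to `B`. -/
lemma setIntegral_le_measureReal_mul_log {Ω ι : Type*} [MeasurableSpace Ω] {μ : Measure Ω}
    [IsProbabilityMeasure μ] [Fintype ι] [Nonempty ι] {B : Set Ω} (hB : MeasurableSet B)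
    {U : ι → Ω → ℝ} (hm : ∀ i, Measurable (U i))
    (hU : ∀ i, ∫⁻ ω, ENNReal.ofReal (Real.exp (U i ω)) ∂μ ≤ 1)
    (hoff : ∀ i, ∀ ω ∉ B, U i ω = 0) {X : Ω → ℝ} (hX : Integrable X μ)
    (hXU : ∀ ω ∈ B, ∃ i, X ω ≤ U i ω) :
    ∫ ω in B, X ω ∂μ ≤ μ.real B * Real.log (Fintype.card ι) := by
  have hN : (0 : ℝ) < Fintype.card ι := by exact_mod_cast Fintype.card_pos
  have hint (i) := (integrable_exp_of_lintegral_le_one (hm i) (hU i)).1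
  have hle (i) := (integrable_exp_of_lintegral_le_one (hm i) (hU i)).2
  have hB' (i) : ∫ ω in B, Real.exp (U i ω) ∂μ ≤ μ.real B := by
    have h1 := integral_add_compl hB (hint i)
    -- Off `B` the exponential equals one, so `Bᶜ` uses up exactly its own mass of the total
    -- exponential moment and at most `μ B` is left for `B`.
    have h2 : ∫ ω in Bᶜ, Real.exp (U i ω) ∂μ = μ.real Bᶜ := by
      rw [setIntegral_congr_fun hB.compl (g := fun _ => (1 : ℝ))
        (fun ω hω => by simp [hoff i ω hω])]
      simp
    rw [h2, probReal_compl_eq_one_sub hB] at h1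
    linarith [hle i]
  have key : ∀ ω ∈ B, X ω ≤ (∑ i, Real.exp (U i ω)) / Fintype.card ι
      + (Real.log (Fintype.card ι) - 1) := by
    intro ω hω
    obtain ⟨i, hi⟩ := hXU ω hω
    have h1 : Real.exp (X ω) ≤ ∑ i, Real.exp (U i ω) :=
      (Real.exp_le_exp.2 hi).trans (Finset.single_le_sum (f := fun i => Real.exp (U i ω))
        (fun _ _ => (Real.exp_pos _).le) (Finset.mem_univ i))
    -- The tangent to `log` at the number of indices replaces Jensen's inequality conditionally on
    -- `B`, so a null event `B` needs no separate treatment.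
    have h2 := Real.log_le_sub_one_of_pos (div_pos (Real.exp_pos (X ω)) hN)
    rw [Real.log_div (Real.exp_pos _).ne' hN.ne', Real.log_exp] at h2
    have h3 := div_le_div_of_nonneg_right h1 hN.le
    linarith
  calc ∫ ω in B, X ω ∂μ
      ≤ ∫ ω in B, ((∑ i, Real.exp (U i ω)) / Fintype.card ι
          + (Real.log (Fintype.card ι) - 1)) ∂μ :=
        setIntegral_mono_on hX.integrableOn
          (((integrable_finsetSum _ fun i _ => (hint i).integrableOn).div_const _).add
            (integrable_const _)) hB key
    _ = (∑ i, ∫ ω in B, Real.exp (U i ω) ∂μ) / Fintype.card ι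
          + μ.real B * (Real.log (Fintype.card ι) - 1) := by
        rw [integral_add ((integrable_finsetSum _ fun i _ => (hint i).integrableOn).div_const _)
          (integrable_const _), integral_div,
          integral_finsetSum _ fun i _ => (hint i).integrableOn]
        simp
    _ ≤ (∑ _i : ι, μ.real B) / Fintype.card ι
          + μ.real B * (Real.log (Fintype.card ι) - 1) := by
        gcongr with i
        exact hB' i
    _ = μ.real B * Real.log (Fintype.card ι) := by
        simp only [Finset.sum_const, Finset.card_univ, nsmul_eq_mul]
        field_simp
        ring

/-! ### Epochs of the realized variance -/

/-- The variance of a Bernoulli variable with mean `p`. -/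
def bernVar (p : I) : ℝ := (p : ℝ) * (1 - (p : ℝ))

lemma bernVar_nonneg (p : I) : 0 ≤ bernVar p := mul_nonneg p.2.1 (by linarith [p.2.2])

lemma bernVar_le (p : I) : bernVar p ≤ 1 / 4 := by
  unfold bernVar; nlinarith [sq_nonneg ((p : ℝ) - 1 / 2)]

lemma measurable_bernVar : Measurable bernVar := by unfold bernVar; fun_prop

lemma measurable_bit : Measurable bit := Measurable.of_discrete

lemma measurable_realizedVar {T : ℕ} : Measurable (realizedVar (T := T)) := by
  unfold realizedVar condProbs; fun_prop

lemma realizedVar_eq {T : ℕ} (ω : Transcript T) : realizedVar ω = ∑ t, bernVar (ω t).2 := rfl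

lemma realizedVar_nonneg {T : ℕ} (ω : Transcript T) : 0 ≤ realizedVar ω :=
  Finset.sum_nonneg fun t _ => bernVar_nonneg (ω t).2

lemma realizedVar_le {T : ℕ} (ω : Transcript T) : realizedVar ω ≤ T / 4 := by
  rw [realizedVar_eq]
  refine (Finset.sum_le_sum fun t _ => bernVar_le (ω t).2).trans (le_of_eq ?_)
  simp [div_eq_mul_inv]

lemma realizedVar_pre_le {T : ℕ} (ω : Transcript T) (t : Fin T) :
    realizedVar (pre ω t) ≤ realizedVar ω := by
  rw [realizedVar_eq, realizedVar_eq]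
  have h := Finset.sum_map Finset.univ (Fin.castLEEmb t.isLt.le) fun s : Fin T => bernVar (ω s).2
  refine h.symm.trans_le ?_
  exact Finset.sum_le_sum_of_subset_of_nonneg (Finset.subset_univ _)
    fun s _ _ => bernVar_nonneg _

open Classical in
/-- The sum of `F` over those rounds before which the realized variance lies in `[lo, hi)`. -/
def epochSum (lo hi : ℝ) (F : ℕ → Bool × I → ℝ) {T : ℕ} (ω : Transcript T) : ℝ :=
  ∑ t : Fin T, if realizedVar (pre ω t) ∈ Set.Ico lo hi then F t (ω t) else 0

lemma measurable_epochSum (lo hi : ℝ) {F : ℕ → Bool × I → ℝ} (hF : ∀ n, Measurable (F n)) (T : ℕ) :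
    Measurable (epochSum lo hi F (T := T)) := by
  refine Finset.measurable_sum _ fun t _ => Measurable.ite ?_ ?_ measurable_const
  · exact (measurable_realizedVar.comp (measurable_pre t)) measurableSet_Ico
  · exact (hF t).comp (measurable_pi_apply t)

lemma epochSum_eq_zero {lo hi : ℝ} (F : ℕ → Bool × I → ℝ) {T : ℕ} {ω : Transcript T}
    (h : realizedVar ω < lo) : epochSum lo hi F ω = 0 :=
  Finset.sum_eq_zero fun t _ =>
    if_neg fun ht => absurd (ht.1.trans (realizedVar_pre_le ω t)) (not_le.2 h)

lemma epochSum_add (lo hi : ℝ) (F G : ℕ → Bool × I → ℝ) {T : ℕ} (ω : Transcript T) :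
    epochSum lo hi (fun n z => F n z + G n z) ω = epochSum lo hi F ω + epochSum lo hi G ω := by
  simp only [epochSum, ← Finset.sum_add_distrib]
  refine Finset.sum_congr rfl fun t _ => ?_
  split_ifs <;> simp

lemma epochSum_const_mul (lo hi a : ℝ) (F : ℕ → Bool × I → ℝ) {T : ℕ} (ω : Transcript T) :
    epochSum lo hi (fun n z => a * F n z) ω = a * epochSum lo hi F ω := by
  simp only [epochSum, Finset.mul_sum]
  refine Finset.sum_congr rfl fun t _ => ?_
  split_ifs <;> simp

lemma epochSum_mono {lo hi : ℝ} {F G : ℕ → Bool × I → ℝ} (h : ∀ n z, F n z ≤ G n z) {T : ℕ}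
    (ω : Transcript T) : epochSum lo hi F ω ≤ epochSum lo hi G ω := by
  refine Finset.sum_le_sum fun t _ => ?_
  split_ifs
  · exact h _ _
  · exact le_rfl

lemma abs_epochSum_le_epochSum_abs (lo hi : ℝ) (F : ℕ → Bool × I → ℝ) {T : ℕ} (ω : Transcript T) :
    |epochSum lo hi F ω| ≤ epochSum lo hi (fun n z => |F n z|) ω := by
  refine (Finset.abs_sum_le_sum_abs _ _).trans (le_of_eq (Finset.sum_congr rfl fun t _ => ?_))
  split_ifs <;> simp

lemma epochSum_const_le (lo hi : ℝ) {a : ℝ} (ha : 0 ≤ a) {T : ℕ} (ω : Transcript T) :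
    epochSum lo hi (fun _ _ => a) ω ≤ T * a := by
  refine (Finset.sum_le_sum (g := fun _ => a) fun t _ => ?_).trans (by simp)
  split_ifs <;> simp [ha]

lemma abs_epochSum_le {lo hi : ℝ} {F : ℕ → Bool × I → ℝ} (hF : ∀ n z, |F n z| ≤ 1) {T : ℕ}
    (ω : Transcript T) : |epochSum lo hi F ω| ≤ T := by
  refine (abs_epochSum_le_epochSum_abs lo hi F ω).trans ((epochSum_mono hF ω).trans ?_)
  simpa using epochSum_const_le lo hi zero_le_one ω

/-- A round belongs to the epoch only if the variance before it is below `hi`; only the last such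
round can overshoot, by at most `1 / 4`. The induction carries along the bound by the full realized
variance. -/
lemma epochSum_bernVar_le {lo hi : ℝ} (hhi : 0 ≤ hi) {T : ℕ} (ω : Transcript T) :
    epochSum lo hi (fun _ z => bernVar z.2) ω ≤ hi + 1 / 4 := by
  suffices h : epochSum lo hi (fun _ z => bernVar z.2) ω ≤ realizedVar ω ∧
      epochSum lo hi (fun _ z => bernVar z.2) ω ≤ hi + 1 / 4 from h.2
  induction T with
  | zero => simp [epochSum, realizedVar]; linarith
  | succ n ih =>
    obtain ⟨h1, h2⟩ := ih (pre ω (Fin.last n))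
    have hV : realizedVar ω = realizedVar (pre ω (Fin.last n)) + bernVar (ω (Fin.last n)).2 := by
      rw [realizedVar_eq, Fin.sum_univ_castSucc, realizedVar_eq]; rfl
    have hS : epochSum lo hi (fun _ z => bernVar z.2) ω =
        epochSum lo hi (fun _ z => bernVar z.2) (pre ω (Fin.last n)) +
          open Classical in if realizedVar (pre ω (Fin.last n)) ∈ Set.Ico lo hi then
            bernVar (ω (Fin.last n)).2 else 0 := by
      rw [epochSum, Fin.sum_univ_castSucc]; rfl
    have h0 := bernVar_nonneg (ω (Fin.last n)).2
    have h4 := bernVar_le (ω (Fin.last n)).2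
    rw [hS, hV]
    split_ifs with hc
    · exact ⟨by linarith, by linarith [hc.2]⟩
    · exact ⟨by linarith, by linarith⟩

/-- Whether a round belongs to the epoch is decided by the rounds before it, so restricting to the
epoch preserves the supermartingale property. -/
lemma lintegral_exp_epochSum_le_one (P : Nature) (lo hi : ℝ) {F : ℕ → Bool × I → ℝ}
    (hF : ∀ n, Measurable (F n)) (T : ℕ)
    (h : ∀ n < T, ∀ x : Fin n → Bool,
      ∫⁻ z, ENNReal.ofReal (Real.exp (F n z)) ∂roundLaw (P n x : Measure I) ≤ 1) :
    ∫⁻ ω, ENNReal.ofReal (Real.exp (epochSum lo hi F ω)) ∂law P T ≤ 1 := by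
  classical
  refine lintegral_exp_sum_le_one P
    (fun n h z => if realizedVar h ∈ Set.Ico lo hi then F n z else 0) (fun n => ?_) T
    fun n hn x => ?_
  · exact Measurable.ite ((measurable_realizedVar.comp measurable_fst) measurableSet_Ico)
      ((hF n).comp measurable_snd) measurable_const
  · split_ifs
    · exact h n hn _
    · simp

/-! ### One round -/

/-- Apply `exp y ≤ 1 + y + y²` for `|y| ≤ 1`; the linear terms cancel by centring. -/
lemma bernoulli_exp_le {p s : ℝ} (h0 : 0 ≤ p) (h1 : p ≤ 1) (hs : |s| ≤ 1) :
    p * Real.exp (s * (1 - p)) + (1 - p) * Real.exp (s * (0 - p)) ≤ 1 + s ^ 2 * (p * (1 - p)) := by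
  have e (y : ℝ) (hy : |y| ≤ 1) : Real.exp y ≤ 1 + y + y ^ 2 := by
    have := abs_le.1 (Real.abs_exp_sub_one_sub_id_le hy)
    linarith [this.2]
  have e1 := e (s * (1 - p)) (by
    rw [abs_mul, abs_of_nonneg (by linarith : 0 ≤ 1 - p)]
    nlinarith [abs_nonneg s])
  have e2 := e (s * (0 - p)) (by
    rw [abs_mul, zero_sub, abs_neg, abs_of_nonneg h0]
    nlinarith [abs_nonneg s])
  have := add_le_add (mul_le_mul_of_nonneg_left e1 h0)
    (mul_le_mul_of_nonneg_left e2 (by linarith : 0 ≤ 1 - p))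
  refine this.trans (le_of_eq ?_)
  ring

lemma exp_neg_le {y : ℝ} (h0 : 0 ≤ y) (h1 : y ≤ 1) : Real.exp (-y) ≤ 1 - y / 2 := by
  have := abs_le.1 (Real.abs_exp_sub_one_sub_id_le (x := -y) (by rwa [abs_neg, abs_of_nonneg h0]))
  by_cases hy : y ≤ 1 / 2
  · nlinarith [this.2]
  -- For larger `y` the quadratic bound is too weak; the chord from `0` to `-1` suffices because
  -- `exp (-1) ≤ 1 / 2`.
  · have hc := convexOn_exp.2 (Set.mem_univ (0 : ℝ)) (Set.mem_univ (-1 : ℝ))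
      (by linarith : 0 ≤ 1 - y) h0 (by ring)
    have h2 : Real.exp (-1) ≤ 1 / 2 := by
      rw [Real.exp_neg, inv_le_comm₀ (Real.exp_pos 1) (by norm_num)]
      linarith [Real.exp_one_gt_d9]
    simp only [smul_eq_mul, mul_zero, zero_add, mul_neg, mul_one, Real.exp_zero] at hc
    nlinarith

/-- The prediction error of the truthful forecaster in a round, if its prediction lies in `D`. -/
def residual (D : Set I) (z : Bool × I) : ℝ := D.indicator (fun p : I => bit z.1 - (p : ℝ)) z.2

lemma measurable_residual {D : Set I} (hD : MeasurableSet D) : Measurable (residual D) := by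
  have : residual D = (Prod.snd ⁻¹' D).indicator fun z : Bool × I => bit z.1 - (z.2 : ℝ) := by
    funext z; simp only [residual, Set.indicator]; rfl
  rw [this]
  exact ((measurable_bit.comp measurable_fst).sub
    (measurable_subtype_coe.comp measurable_snd)).indicator (measurable_snd hD)

lemma abs_residual_le (D : Set I) (z : Bool × I) : |residual D z| ≤ 1 := by
  by_cases h : z.2 ∈ D
  · simpa [residual, h] using abs_bit_sub_le z.1 z.2
  · simp [residual, h]

/-- The exponential moment of a round, with variance compensated. -/
lemma lintegral_exp_round_le_one (μ : Measure I) [IsProbabilityMeasure μ] {D : Set I}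
    (hD : MeasurableSet D) {l s ρ : ℝ} (hs : |s| ≤ l) (hl : l ≤ 1) (hρ : 0 ≤ ρ)
    (hlρ : l ^ 2 * ρ ≤ 2)
    (hv : ∫ p, D.indicator bernVar p ∂μ ≤ ρ * ∫ p, bernVar p ∂μ) :
    ∫⁻ z, ENNReal.ofReal (Real.exp (s * residual D z - 2 * l ^ 2 * ρ * bernVar z.2)) ∂roundLaw μ ≤ 1 := by
  have hm : Measurable fun z : Bool × I => ENNReal.ofReal (Real.exp
      (s * residual D z - 2 * l ^ 2 * ρ * bernVar z.2)) :=
    (((measurable_residual hD).const_mul s).sub ((measurable_bernVar.comp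
      measurable_snd).const_mul (2 * l ^ 2 * ρ))).exp.ennreal_ofReal
  rw [lintegral_roundLaw μ hm]
  unfold residual
  have hlsq : 0 ≤ l ^ 2 := sq_nonneg l
  -- Given `p`, the compensator factors out and is at most `1 - l²ρ · bernVar p`. It involves the
  -- whole variance, not only the part in `D`, so the two second-order terms balance only after
  -- averaging over `p` by `hv`.
  have hpt (p : I) : ENNReal.ofReal p * ENNReal.ofReal (Real.exp
        (s * D.indicator (fun p : I => bit true - (p : ℝ)) p - 2 * l ^ 2 * ρ * bernVar p))
      + ENNReal.ofReal (1 - p) * ENNReal.ofReal (Real.exp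
        (s * D.indicator (fun p : I => bit false - (p : ℝ)) p - 2 * l ^ 2 * ρ * bernVar p))
      ≤ ENNReal.ofReal (1 + l ^ 2 * D.indicator bernVar p - l ^ 2 * ρ * bernVar p) := by
    have h0 := p.2.1
    have h1 := p.2.2
    rw [← ENNReal.ofReal_mul h0, ← ENNReal.ofReal_mul (by linarith),
      ← ENNReal.ofReal_add (by positivity) (mul_nonneg (by linarith) (Real.exp_pos _).le)]
    refine ENNReal.ofReal_le_ofReal ?_
    have hv0 := bernVar_nonneg p
    have hv1 := bernVar_le p
    have hy0 : 0 ≤ 2 * l ^ 2 * ρ * bernVar p := by positivity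
    have hlρ0 : 0 ≤ l ^ 2 * ρ := by positivity
    have hy := exp_neg_le hy0 (by nlinarith)
    have hmain : (p : ℝ) * Real.exp (s * D.indicator (fun p : I => bit true - (p : ℝ)) p)
        + (1 - p) * Real.exp (s * D.indicator (fun p : I => bit false - (p : ℝ)) p)
        ≤ 1 + l ^ 2 * D.indicator bernVar p := by
      by_cases hp : p ∈ D
      · simp only [Set.indicator_of_mem hp, bit]
        refine (bernoulli_exp_le h0 h1 (hs.trans hl)).trans ?_
        have : s ^ 2 ≤ l ^ 2 := sq_le_sq' (by linarith [neg_abs_le s]) (by linarith [le_abs_self s])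
        have := mul_le_mul_of_nonneg_right this hv0
        simp only [bernVar] at this ⊢
        linarith
      · simp [Set.indicator_of_notMem hp]
    have hi0 : 0 ≤ D.indicator bernVar p := Set.indicator_nonneg (fun p _ => bernVar_nonneg p) p
    simp only [sub_eq_add_neg, Real.exp_add]
    simp only [sub_eq_add_neg] at hmain hy
    calc _ = ((p : ℝ) * Real.exp (s * D.indicator (fun p : I => bit true + -(p : ℝ)) p)
          + (1 + -(p : ℝ)) * Real.exp (s * D.indicator (fun p : I => bit false + -(p : ℝ)) p))
          * Real.exp (-(2 * l ^ 2 * ρ * bernVar p)) := by ring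
      _ ≤ (1 + l ^ 2 * D.indicator bernVar p) * (1 + -(2 * l ^ 2 * ρ * bernVar p / 2)) :=
          mul_le_mul hmain hy (Real.exp_pos _).le (by positivity)
      _ ≤ _ := by
          have : 0 ≤ l ^ 2 * D.indicator bernVar p * (l ^ 2 * ρ * bernVar p) := by positivity
          linarith
  refine (lintegral_mono hpt).trans ?_
  have hiv : Integrable bernVar μ := Integrable.of_bound (C := 1 / 4)
    measurable_bernVar.aestronglyMeasurable (Filter.Eventually.of_forall fun p => by
      rw [Real.norm_of_nonneg (bernVar_nonneg p)]; exact bernVar_le p)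
  have hiD : Integrable (D.indicator bernVar) μ := hiv.indicator hD
  have hi1 : Integrable (fun p => 1 + l ^ 2 * D.indicator bernVar p) μ :=
    (integrable_const _).add (hiD.const_mul _)
  have hi : Integrable (fun p => 1 + l ^ 2 * D.indicator bernVar p - l ^ 2 * ρ * bernVar p) μ :=
    hi1.sub (hiv.const_mul _)
  rw [← ofReal_integral_eq_lintegral_ofReal hi (Filter.Eventually.of_forall fun p => ?_)]
  · rw [integral_sub hi1 (hiv.const_mul _),
      integral_add (integrable_const _) (hiD.const_mul _), integral_const_mul, integral_const_mul]
    refine ENNReal.ofReal_le_one.2 ?_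
    simp only [integral_const, probReal_univ, smul_eq_mul, mul_one]
    nlinarith [mul_le_mul_of_nonneg_left hv hlsq]
  · have hv0 := bernVar_nonneg p
    have hv1 := bernVar_le p
    have hi0 : 0 ≤ D.indicator bernVar p := Set.indicator_nonneg (fun p _ => bernVar_nonneg p) p
    have : 0 ≤ l ^ 2 * D.indicator bernVar p := by positivity
    have : l ^ 2 * ρ * bernVar p ≤ 2 * (1 / 4) :=
      mul_le_mul hlρ hv1 hv0 (by norm_num)
    simp only [Pi.zero_apply]
    linarith

/-- The exponential moment of the indicator of a prediction, with its mean compensated. -/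
lemma lintegral_exp_count_round_le_one (μ : Measure I) [IsProbabilityMeasure μ] {D : Set I}
    (hD : MeasurableSet D) {q : ℝ} (hq : μ.real D ≤ q) :
    ∫⁻ z, ENNReal.ofReal (Real.exp (D.indicator (fun _ => (1 : ℝ)) z.2 - 2 * q)) ∂roundLaw μ
      ≤ 1 := by
  have hi : Measurable (D.indicator fun _ => (1 : ℝ)) := measurable_const.indicator hD
  have hm : Measurable fun z : Bool × I =>
      ENNReal.ofReal (Real.exp (D.indicator (fun _ => (1 : ℝ)) z.2 - 2 * q)) :=
    ((hi.comp measurable_snd).sub_const (2 * q)).exp.ennreal_ofReal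
  rw [lintegral_roundLaw μ hm]
  have hint : Integrable (fun p => Real.exp (-(2 * q)) * (1 + 2 * D.indicator (fun _ => 1) p)) μ :=
    ((integrable_const _).add (((integrable_const _).indicator hD).const_mul _)).const_mul _
  have h0 (p : I) : 0 ≤ D.indicator (fun _ => (1 : ℝ)) p := by
    by_cases hp : p ∈ D <;> simp [hp]
  refine (lintegral_mono (g := fun p => ENNReal.ofReal
    (Real.exp (-(2 * q)) * (1 + 2 * D.indicator (fun _ => 1) p))) fun p => ?_).trans ?_
  · rw [← add_mul, ← ENNReal.ofReal_add p.2.1 (by linarith [p.2.2])]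
    simp only [add_sub_cancel, ENNReal.ofReal_one, one_mul]
    refine ENNReal.ofReal_le_ofReal ?_
    rw [sub_eq_neg_add, Real.exp_add]
    refine mul_le_mul_of_nonneg_left ?_ (Real.exp_pos _).le
    by_cases hp : p ∈ D
    · simp only [hp, Set.indicator_of_mem]
      -- Here `e ≤ 1 + 2` is used; later `1 + 2q ≤ exp (2q)` absorbs the mean.
      linarith [Real.exp_one_lt_d9]
    · simp [hp]
  · rw [← ofReal_integral_eq_lintegral_ofReal hint
      (Filter.Eventually.of_forall fun p => by
        have := h0 p
        simp only [Pi.zero_apply]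
        positivity)]
    refine ENNReal.ofReal_le_one.2 ?_
    rw [integral_const_mul, integral_add (integrable_const _)
      (((integrable_const _).indicator hD).const_mul _), integral_const_mul,
      integral_indicator_const _ hD]
    simp only [integral_const, probReal_univ, smul_eq_mul, mul_one]
    rw [Real.exp_neg, inv_mul_le_iff₀ (Real.exp_pos _), mul_one]
    linarith [Real.add_one_le_exp (2 * q)]

/-! ### Maximal inequalities in an epoch -/

lemma abs_iSup_le {ι : Type*} [Nonempty ι] {f : ι → ℝ} {a : ℝ} (h0 : ∀ i, 0 ≤ f i)
    (h : ∀ i, f i ≤ a) : |⨆ i, f i| ≤ a := by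
  rw [abs_of_nonneg (Real.iSup_nonneg h0)]
  exact ciSup_le h

lemma measurableSet_le_realizedVar (T : ℕ) (a : ℝ) :
    MeasurableSet {ω : Transcript T | a ≤ realizedVar ω} :=
  measurable_realizedVar measurableSet_Ici

section

variable {lo hi : ℝ} {T : ℕ} {ι : Type*} {D : ι → Set I} {w : ℕ → ℝ}

lemma measurable_epochSum_residual (hD : ∀ i, MeasurableSet (D i)) (i : ι) :
    Measurable (epochSum lo hi (fun n z => w n * residual (D i) z) (T := T)) :=
  measurable_epochSum lo hi (fun n => (measurable_residual (hD i)).const_mul (w n)) T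

variable [Fintype ι] [Nonempty ι]

lemma integrable_iSup_epochSum_residual (P : Nature) (hD : ∀ i, MeasurableSet (D i))
    (hw : ∀ n, |w n| ≤ 1) :
    Integrable (fun ω => ⨆ i, |epochSum lo hi (fun n z => w n * residual (D i) z) ω|)
      (law P T) := by
  refine Integrable.of_bound (C := (T : ℝ)) ?_ (Filter.Eventually.of_forall fun ω => ?_)
  · exact (Measurable.iSup fun i => (measurable_epochSum_residual hD i).abs).aestronglyMeasurable
  · refine abs_iSup_le (fun _ => abs_nonneg _) fun i => abs_epochSum_le (fun n z => ?_) ω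
    rw [abs_mul]
    exact mul_le_one₀ (hw n) (abs_nonneg _) (abs_residual_le _ z)

/-- The Chernoff form with free parameter `l`: the first term is the compensator over the epoch, the
second the union bound, both divided by `l`. -/
lemma setIntegral_iSup_epochSum_le_aux (P : Nature) (hhi : 0 ≤ hi)
    (hD : ∀ i, MeasurableSet (D i)) (hw : ∀ n, |w n| ≤ 1) {ρ l : ℝ} (hρ : 0 ≤ ρ) (hl0 : 0 < l)
    (hl1 : l ≤ 1) (hlρ : l ^ 2 * ρ ≤ 2)
    (hv : ∀ n < T, ∀ x : Fin n → Bool, ∀ i, ∫ p, (D i).indicator bernVar p ∂(P n x : Measure I)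
      ≤ ρ * ∫ p, bernVar p ∂(P n x : Measure I)) :
    ∫ ω in {ω | lo ≤ realizedVar ω},
        ⨆ i, |epochSum lo hi (fun n z => w n * residual (D i) z) ω| ∂law P T
      ≤ (law P T).real {ω | lo ≤ realizedVar ω} *
        (2 * l * ρ * (hi + 1 / 4) + Real.log (2 * Fintype.card ι) / l) := by
  set R := hi + 1 / 4
  set M : ι → Transcript T → ℝ := fun i => epochSum lo hi (fun n z => w n * residual (D i) z)
  set V : Transcript T → ℝ := epochSum lo hi (fun _ z => bernVar z.2)
  set B : Set (Transcript T) := {ω | lo ≤ realizedVar ω}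
  have hB : MeasurableSet B := measurableSet_le_realizedVar T lo
  let sg : Bool → ℝ := fun b => if b then 1 else -1
  -- The Boolean index selects a sign, which handles the absolute value and doubles the cardinality
  -- in the logarithm.
  let F : ι × Bool → ℕ → Bool × I → ℝ := fun j n z =>
    (l * sg j.2 * w n) * residual (D j.1) z - 2 * l ^ 2 * ρ * bernVar z.2
  have hF (j : ι × Bool) (n : ℕ) : Measurable (F j n) :=
    ((measurable_residual (hD j.1)).const_mul _).sub
      ((measurable_bernVar.comp measurable_snd).const_mul _)
  have hU (j : ι × Bool) (ω : Transcript T) :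
      epochSum lo hi (F j) ω = l * sg j.2 * M j.1 ω - 2 * l ^ 2 * ρ * V ω := by
    have : F j = fun n z => l * sg j.2 * (w n * residual (D j.1) z)
        + -(2 * l ^ 2 * ρ) * bernVar z.2 := by
      funext n z; simp only [F]; ring
    rw [this, epochSum_add, epochSum_const_mul, epochSum_const_mul]
    simp only [M, V]; ring
  have hint : Integrable (fun ω => ⨆ i, |M i ω|) (law P T) :=
    integrable_iSup_epochSum_residual P hD hw
  have key := setIntegral_le_measureReal_mul_log (μ := law P T) hB
    (U := fun j => epochSum lo hi (F j)) (fun j => measurable_epochSum lo hi (hF j) T)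
    (fun j => lintegral_exp_epochSum_le_one P lo hi (hF j) T fun n hn x =>
      lintegral_exp_round_le_one _ (hD j.1) (by
        have h1 : |sg j.2| = 1 := by simp only [sg]; split_ifs <;> simp
        rw [abs_mul, abs_mul, h1, abs_of_pos hl0, mul_one]
        exact mul_le_of_le_one_right hl0.le (hw n)) hl1 hρ hlρ (hv n hn x j.1))
    (fun j ω hω => epochSum_eq_zero _ (not_le.1 hω))
    (X := fun ω => l * (⨆ i, |M i ω|) - 2 * l ^ 2 * ρ * R)
    ((hint.const_mul l).sub (integrable_const _)) (fun ω _ => by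
      obtain ⟨i, hi'⟩ := exists_eq_ciSup_of_finite (f := fun i => |M i ω|)
      have hVR : V ω ≤ R := epochSum_bernVar_le hhi ω
      have h2 : 2 * l ^ 2 * ρ * V ω ≤ 2 * l ^ 2 * ρ * R :=
        mul_le_mul_of_nonneg_left hVR (by positivity)
      refine ⟨(i, decide (0 ≤ M i ω)), ?_⟩
      have hsg : sg (decide (0 ≤ M i ω)) * M i ω = |M i ω| := by
        by_cases h : 0 ≤ M i ω
        · simp [sg, h, abs_of_nonneg h]
        · simp [sg, h, abs_of_neg (not_le.1 h)]
      rw [hU, ← hi', mul_assoc l, hsg]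
      linarith)
  rw [integral_sub (hint.integrableOn.const_mul l) (integrable_const _), integral_const_mul] at key
  simp only [integral_const, measureReal_restrict_apply_univ, smul_eq_mul, Fintype.card_prod,
    Fintype.card_bool, Nat.cast_mul, Nat.cast_ofNat] at key
  rw [mul_comm (Fintype.card ι : ℝ) 2] at key
  have : l * ∫ ω in B, ⨆ i, |M i ω| ∂law P T ≤ l * ((law P T).real B *
      (2 * l * ρ * R + Real.log (2 * Fintype.card ι) / l)) := by
    have e : l * ((law P T).real B * (2 * l * ρ * R + Real.log (2 * Fintype.card ι) / l)) =
        (law P T).real B * (2 * l ^ 2 * ρ * R) +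
          (law P T).real B * Real.log (2 * Fintype.card ι) := by
      field_simp
    rw [e]; linarith
  exact le_of_mul_le_mul_left this hl0

/-- The largest of finitely many error sums in an epoch, if the sets of predictions carry at most
the fraction `ρ` of the variance. -/
lemma setIntegral_iSup_epochSum_le (P : Nature) (hhi : 0 ≤ hi)
    (hD : ∀ i, MeasurableSet (D i)) (hw : ∀ n, |w n| ≤ 1) {ρ N : ℝ} (hρ : 0 ≤ ρ) (hρ2 : ρ ≤ 2)
    (hv : ∀ n < T, ∀ x : Fin n → Bool, ∀ i, ∫ p, (D i).indicator bernVar p ∂(P n x : Measure I)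
      ≤ ρ * ∫ p, bernVar p ∂(P n x : Measure I))
    (hN0 : 0 < N) (hN : Real.log (2 * Fintype.card ι) ≤ N) :
    ∫ ω in {ω | lo ≤ realizedVar ω},
        ⨆ i, |epochSum lo hi (fun n z => w n * residual (D i) z) ω| ∂law P T
      ≤ (law P T).real {ω | lo ≤ realizedVar ω} *
        (3 * √(ρ * (hi + 1 / 4) * N) + 3 * N) := by
  have hR : 0 < hi + 1 / 4 := by linarith
  suffices h : ∃ l : ℝ, 0 < l ∧ l ≤ 1 ∧
      2 * l * ρ * (hi + 1 / 4) + N / l ≤ 3 * √(ρ * (hi + 1 / 4) * N) + 3 * N by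
    obtain ⟨l, hl0, hl1, hl⟩ := h
    refine (setIntegral_iSup_epochSum_le_aux P hhi hD hw hρ hl0 hl1 ?_ hv).trans ?_
    · nlinarith
    · refine mul_le_mul_of_nonneg_left (le_trans ?_ hl) measureReal_nonneg
      gcongr
  by_cases hc : ρ * (hi + 1 / 4) ≤ N
  · exact ⟨1, one_pos, le_rfl, by
      have := Real.sqrt_nonneg (ρ * (hi + 1 / 4) * N)
      simp only [mul_one, div_one]
      linarith⟩
  · push Not at hc
    have hρR : 0 < ρ * (hi + 1 / 4) := hN0.trans hc
    -- This choice makes `l * ρ * (hi + 1 / 4)` equal to `N / l`; it is admissible only when it is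
    -- at most one, and otherwise `l = 1` was taken.
    refine ⟨√N / √(ρ * (hi + 1 / 4)), by positivity, ?_, ?_⟩
    · rw [div_le_one (by positivity)]
      exact Real.sqrt_le_sqrt hc.le
    · have e1 : √(ρ * (hi + 1 / 4)) ^ 2 = ρ * (hi + 1 / 4) := Real.sq_sqrt hρR.le
      have e2 : √N ^ 2 = N := Real.sq_sqrt hN0.le
      have h1 : 0 < √(ρ * (hi + 1 / 4)) := Real.sqrt_pos.2 hρR
      have h2 : 0 < √N := Real.sqrt_pos.2 hN0
      rw [Real.sqrt_mul hρR.le]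
      set a := √(ρ * (hi + 1 / 4))
      have e3 : 2 * (√N / a) * ρ * (hi + 1 / 4) = 2 * (a * √N) := by
        calc _ = 2 * √N * (ρ * (hi + 1 / 4)) / a := by ring
          _ = _ := by rw [← e1]; field_simp
      have e4 : N / (√N / a) = a * √N := by
        rw [div_div_eq_mul_div, div_eq_iff h2.ne']
        nth_rewrite 1 [← e2]; ring
      rw [e3, e4]
      linarith

/-- The largest number of predictions in an epoch that lie in one of finitely many sets. -/
lemma setIntegral_iSup_epochCount_le (P : Nature) (hD : ∀ i, MeasurableSet (D i)) {q N : ℝ}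
    (hq0 : 0 ≤ q)
    (hq : ∀ n < T, ∀ x : Fin n → Bool, ∀ i, (P n x : Measure I).real (D i) ≤ q)
    (hN : Real.log (Fintype.card ι) ≤ N) :
    Integrable (fun ω => ⨆ i, epochSum lo hi (fun _ z => (D i).indicator (fun _ => (1 : ℝ)) z.2) ω)
      (law P T) ∧
    ∫ ω in {ω | lo ≤ realizedVar ω},
        ⨆ i, epochSum lo hi (fun _ z => (D i).indicator (fun _ => (1 : ℝ)) z.2) ω ∂law P T
      ≤ (law P T).real {ω | lo ≤ realizedVar ω} * (2 * T * q + N) := by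
  set B : Set (Transcript T) := {ω | lo ≤ realizedVar ω}
  set M : ι → Transcript T → ℝ :=
    fun i => epochSum lo hi (fun _ z => (D i).indicator (fun _ => (1 : ℝ)) z.2)
  have hB : MeasurableSet B := measurableSet_le_realizedVar T lo
  have hI (i : ι) : Measurable fun z : Bool × I => (D i).indicator (fun _ => (1 : ℝ)) z.2 :=
    (measurable_const.indicator (hD i)).comp measurable_snd
  have h01 (i : ι) (p : I) : 0 ≤ (D i).indicator (fun _ => (1 : ℝ)) p ∧
      (D i).indicator (fun _ => (1 : ℝ)) p ≤ 1 := by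
    by_cases h : p ∈ D i <;> simp [h]
  have hM0 (i : ι) (ω : Transcript T) : 0 ≤ M i ω := by
    refine Finset.sum_nonneg fun t _ => ?_
    split_ifs
    · exact (h01 i _).1
    · exact le_rfl
  have hMT (i : ι) (ω : Transcript T) : M i ω ≤ T :=
    (le_abs_self _).trans (abs_epochSum_le (fun _ z => abs_le.2
      ⟨by linarith [(h01 i z.2).1], (h01 i z.2).2⟩) ω)
  have hMm (i : ι) : Measurable (M i) := measurable_epochSum lo hi (fun _ => hI i) T
  have hint : Integrable (fun ω => ⨆ i, M i ω) (law P T) :=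
    Integrable.of_bound (C := (T : ℝ)) (Measurable.iSup hMm).aestronglyMeasurable
      (Filter.Eventually.of_forall fun ω => abs_iSup_le (fun i => hM0 i ω) fun i => hMT i ω)
  refine ⟨hint, ?_⟩
  let F : ι → ℕ → Bool × I → ℝ := fun i _ z => (D i).indicator (fun _ => (1 : ℝ)) z.2 - 2 * q
  have hF (i : ι) (n : ℕ) : Measurable (F i n) := (hI i).sub_const _
  have key := setIntegral_le_measureReal_mul_log (μ := law P T) hB
    (U := fun i => epochSum lo hi (F i)) (fun i => measurable_epochSum lo hi (hF i) T)
    (fun i => lintegral_exp_epochSum_le_one P lo hi (hF i) T fun n hn x =>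
      lintegral_exp_count_round_le_one _ (hD i) (hq n hn x i))
    (fun i ω hω => epochSum_eq_zero _ (not_le.1 hω))
    (X := fun ω => (⨆ i, M i ω) - T * (2 * q)) (hint.sub (integrable_const _)) (fun ω _ => by
      obtain ⟨i, hi'⟩ := exists_eq_ciSup_of_finite (f := fun i => M i ω)
      refine ⟨i, ?_⟩
      have h1 : M i ω = epochSum lo hi (F i) ω + epochSum lo hi (fun _ _ => 2 * q) ω := by
        rw [← epochSum_add]; simp [F, M]
      have h2 := epochSum_const_le lo hi (a := 2 * q) (by positivity) ω
      linarith)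
  rw [integral_sub hint.integrableOn (integrable_const _)] at key
  simp only [integral_const, measureReal_restrict_apply_univ, smul_eq_mul] at key
  have := mul_le_mul_of_nonneg_left hN (measureReal_nonneg (μ := law P T) (s := B))
  linarith

end

/-! ### Smoothed distributions -/

section

variable {c : ℝ} {μ : Measure I}

lemma HasBoundedDensity.measureReal_le (h : HasBoundedDensity c μ) (hc : 0 < c) {D : Set I}
    (hD : MeasurableSet D) {r : ℝ} (hr : 0 ≤ r) (hDr : (volume : Measure I) D ≤ ENNReal.ofReal r) :
    μ.real D ≤ r / c := by
  obtain ⟨f, -, hf, rfl⟩ := h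
  refine ENNReal.toReal_le_of_le_ofReal (by positivity) ?_
  rw [withDensity_apply _ hD]
  calc ∫⁻ u in D, f u ≤ ∫⁻ _ in D, ENNReal.ofReal (1 / c) := lintegral_mono fun u => hf u
    _ = ENNReal.ofReal (1 / c) * (volume : Measure I) D := by rw [setLIntegral_const]
    _ ≤ ENNReal.ofReal (1 / c) * ENNReal.ofReal r := by gcongr
    _ = ENNReal.ofReal (r / c) := by
        rw [← ENNReal.ofReal_mul (by positivity)]; congr 1; ring

lemma volume_le_of_subset_Icc {D : Set I} {a b : ℝ}
    (h : ∀ p ∈ D, a ≤ (p : ℝ) ∧ (p : ℝ) ≤ b) :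
    (volume : Measure I) D ≤ ENNReal.ofReal (b - a) := by
  rw [Measure.Subtype.volume_def, comap_subtype_coe_apply measurableSet_Icc, ← Real.volume_Icc]
  refine measure_mono ?_
  rintro _ ⟨p, hp, rfl⟩
  exact h p hp

lemma integrable_bernVar [IsFiniteMeasure μ] : Integrable bernVar μ :=
  Integrable.of_bound (C := 1 / 4) measurable_bernVar.aestronglyMeasurable
    (Filter.Eventually.of_forall fun p => by
      rw [Real.norm_of_nonneg (bernVar_nonneg p)]; exact bernVar_le p)

/-- The two end intervals of length `c / 4` have mass at most `1 / 4` each, so at least half of the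
mass lies where `p (1 - p) ≥ c / 8`. -/
lemma HasBoundedDensity.le_integral_bernVar [IsProbabilityMeasure μ] (h : HasBoundedDensity c μ)
    (hc : 0 < c) (hc1 : c ≤ 1) : c / 16 ≤ ∫ p, bernVar p ∂μ := by
  set D : Set I := {p | (p : ℝ) ≤ c / 4}
  set E : Set I := {p | 1 - c / 4 ≤ (p : ℝ)}
  have hD : MeasurableSet D := measurable_subtype_coe measurableSet_Iic
  have hE : MeasurableSet E := measurable_subtype_coe measurableSet_Ici
  have h1 := h.measureReal_le hc hD (by linarith : 0 ≤ c / 4 - 0)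
    (volume_le_of_subset_Icc fun p hp => ⟨p.2.1, hp⟩)
  have h2 := h.measureReal_le hc hE (by linarith : 0 ≤ 1 - (1 - c / 4))
    (volume_le_of_subset_Icc fun p hp => ⟨hp, p.2.2⟩)
  have e1 : (c / 4 - 0) / c = 1 / 4 := by field_simp; ring
  have e2 : (1 - (1 - c / 4)) / c = 1 / 4 := by field_simp; ring
  rw [e1] at h1
  rw [e2] at h2
  have hiD : Integrable (D.indicator fun _ => (1 : ℝ)) μ := (integrable_const _).indicator hD
  have hiE : Integrable (E.indicator fun _ => (1 : ℝ)) μ := (integrable_const _).indicator hE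
  have hi1 : Integrable (fun p => 1 - D.indicator (fun _ => (1 : ℝ)) p) μ :=
    (integrable_const _).sub hiD
  have hi : Integrable (fun p => c / 8 * (1 - D.indicator (fun _ => (1 : ℝ)) p
      - E.indicator (fun _ => (1 : ℝ)) p)) μ :=
    (hi1.sub hiE).const_mul _
  have key : ∫ p, c / 8 * (1 - D.indicator (fun _ => (1 : ℝ)) p
      - E.indicator (fun _ => (1 : ℝ)) p) ∂μ ≤ ∫ p, bernVar p ∂μ := by
    refine integral_mono hi integrable_bernVar fun p => ?_
    have h0 := bernVar_nonneg p
    by_cases hpD : p ∈ D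
    · by_cases hpE : p ∈ E
      · simp only [hpD, hpE, Set.indicator_of_mem]; linarith
      · simpa [hpD, hpE] using h0
    · by_cases hpE : p ∈ E
      · simpa [hpD, hpE] using h0
      · have hpD' : c / 4 < p := not_le.1 hpD
        have hpE' : (p : ℝ) < 1 - c / 4 := not_le.1 hpE
        simp only [hpD, hpE, not_false_eq_true, Set.indicator_of_notMem, bernVar]
        nlinarith
  rw [integral_const_mul, integral_sub hi1 hiE,
    integral_sub (integrable_const _) hiD, integral_indicator_const _ hD,
    integral_indicator_const _ hE] at key
  simp only [integral_const, probReal_univ, smul_eq_mul, mul_one] at key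
  nlinarith

/-- The numerator is at most `(r / c) / 4` and the mean variance is at least `c / 16`. One factor `1
/ c` comes from each estimate. -/
lemma HasBoundedDensity.integral_indicator_bernVar_le [IsProbabilityMeasure μ]
    (h : HasBoundedDensity c μ) (hc : 0 < c) (hc1 : c ≤ 1) {D : Set I} (hD : MeasurableSet D)
    {r : ℝ} (hr : 0 ≤ r) (hDr : (volume : Measure I) D ≤ ENNReal.ofReal r) :
    ∫ p, D.indicator bernVar p ∂μ ≤ 4 * r / c ^ 2 * ∫ p, bernVar p ∂μ := by
  have h1 : ∫ p, D.indicator bernVar p ∂μ ≤ ∫ p, D.indicator (fun _ => 1 / 4) p ∂μ :=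
    integral_mono (integrable_bernVar.indicator hD) ((integrable_const _).indicator hD)
      fun p => Set.indicator_le_indicator (bernVar_le p)
  rw [integral_indicator_const _ hD, smul_eq_mul] at h1
  have h2 := h.measureReal_le hc hD hr hDr
  have h3 := mul_le_mul_of_nonneg_left (h.le_integral_bernVar hc hc1)
    (by positivity : 0 ≤ 4 * r / c ^ 2)
  have h4 : 4 * r / c ^ 2 * (c / 16) = r / c * (1 / 4) := by field_simp; ring
  linarith

end

/-! ### Dyadic chaining -/

/-- The index of the dyadic interval of length `2⁻ᵏ` that contains `p`. -/
def cell (k : ℕ) (p : I) : ℕ := ⌊(2 : ℝ) ^ k * (p : ℝ)⌋₊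

lemma measurable_cell (k : ℕ) : Measurable (cell k) :=
  Nat.measurable_floor.comp (measurable_subtype_coe.const_mul _)

lemma cell_mono (k : ℕ) {p q : I} (h : p ≤ q) : cell k p ≤ cell k q :=
  Nat.floor_mono (mul_le_mul_of_nonneg_left h (by positivity))

/-- The extra index `2 ^ k` is attained at `p = 1`; hence the index types `Fin (2 ^ k + 1)` below.
-/
lemma cell_lt (k : ℕ) (p : I) : cell k p < 2 ^ k + 1 := by
  refine Nat.lt_succ_of_le (Nat.floor_le_of_le ?_)
  push_cast
  exact mul_le_of_le_one_right (by positivity) p.2.2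

lemma cell_succ_div_two (k : ℕ) (p : I) : cell (k + 1) p / 2 = cell k p := by
  unfold cell
  rw [← Nat.floor_div_ofNat]
  congr 1
  rw [pow_succ]
  ring

lemma volume_cell_le (k m : ℕ) :
    (volume : Measure I) {p | cell k p = m} ≤ ENNReal.ofReal (1 / 2 ^ k) := by
  have h2 : (0 : ℝ) < 2 ^ k := by positivity
  refine (volume_le_of_subset_Icc (a := m / 2 ^ k) (b := (m + 1) / 2 ^ k) fun p hp => ?_).trans
    (le_of_eq ?_)
  · have hp' : ⌊(2 : ℝ) ^ k * (p : ℝ)⌋₊ = m := hp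
    rw [Nat.floor_eq_iff (mul_nonneg h2.le p.2.1)] at hp'
    rw [div_le_iff₀ h2, le_div_iff₀ h2]
    constructor <;> linarith [hp'.1, hp'.2]
  · congr 1
    ring

/-- The predictions in the first `m` dyadic intervals of length `2⁻ᵏ`. -/
def initialCells (k m : ℕ) : Set I := {p | cell k p < m}

/-- The predictions in the first `m` dyadic intervals of length `2⁻⁽ᵏ⁺¹⁾` that are not covered by
complete dyadic intervals of twice that length. -/
def linkCells (k m : ℕ) : Set I := {p | cell (k + 1) p < m ∧ cell k p = m / 2}

lemma mem_initialCells {k m : ℕ} {p : I} : p ∈ initialCells k m ↔ cell k p < m := Iff.rfl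

lemma mem_linkCells {k m : ℕ} {p : I} :
    p ∈ linkCells k m ↔ cell (k + 1) p < m ∧ cell k p = m / 2 := Iff.rfl

lemma measurableSet_initialCells (k m : ℕ) : MeasurableSet (initialCells k m) :=
  measurable_cell k measurableSet_Iio

lemma measurableSet_cell (k m : ℕ) : MeasurableSet {p : I | cell k p = m} :=
  measurable_cell k (measurableSet_singleton m)

lemma measurableSet_linkCells (k m : ℕ) : MeasurableSet (linkCells k m) :=
  (measurable_cell (k + 1) measurableSet_Iio).inter (measurableSet_cell k (m / 2))

lemma volume_linkCells_le (k m : ℕ) :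
    (volume : Measure I) (linkCells k m) ≤ ENNReal.ofReal (1 / 2 ^ k) :=
  (measure_mono fun _ hp => hp.2).trans (volume_cell_le k (m / 2))

/-- The chaining step: refining the grid adds to the cells strictly below that of `a` at most one
half of the parent cell of `a`, disjoint from the earlier ones. -/
lemma residual_initialCells_succ (k : ℕ) (a : I) (z : Bool × I) :
    residual (initialCells (k + 1) (cell (k + 1) a)) z =
      residual (initialCells k (cell k a)) z + residual (linkCells k (cell (k + 1) a)) z := by
  have h1 := cell_succ_div_two k z.2
  have h2 := cell_succ_div_two k a
  simp only [residual, Set.indicator, mem_initialCells, mem_linkCells]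
  split_ifs <;> first | omega | simp

/-- By monotonicity of `cell`, the two sets can differ only inside the cell of `a`. -/
lemma abs_residual_Iic_sub_le (k : ℕ) (a : I) (z : Bool × I) :
    |residual (Set.Iic a) z - residual (initialCells k (cell k a)) z| ≤
      {p | cell k p = cell k a}.indicator (fun _ => (1 : ℝ)) z.2 := by
  have h1 : cell k z.2 < cell k a → z.2 ≤ a := fun h =>
    le_of_not_ge fun hle => absurd (cell_mono k hle) (not_le.2 h)
  have h2 : z.2 ≤ a → cell k z.2 ≤ cell k a := fun h => cell_mono k h
  have hb := abs_bit_sub_le z.1 z.2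
  have h3 : z.2 ∈ {p | cell k p = cell k a} ↔ cell k z.2 = cell k a := Iff.rfl
  simp only [residual, Set.indicator, mem_initialCells, h3, Set.mem_Iic]
  split_ifs <;> first | (exfalso; grind) | simp [hb]

/-! ### Chaining within one epoch -/

section

variable {T : ℕ} {c : ℝ} {P : Nature} {w : ℕ → ℝ}

/-- Telescoping over the levels `k, …, k + n`. The right side does not depend on `a`, so on each
transcript it dominates the supremum over all thresholds. Below the finest level no cancellation is
used, only the number of predictions in a cell. -/
lemma abs_epochSum_Iic_le (hw : ∀ n, |w n| ≤ 1) (lo hi : ℝ) (k n : ℕ) (a : I) (ω : Transcript T) :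
    |epochSum lo hi (fun t z => w t * residual (Set.Iic a) z) ω| ≤
      (⨆ m : Fin (2 ^ k + 1),
        |epochSum lo hi (fun t z => w t * residual (initialCells k m) z) ω|)
      + ∑ i ∈ Finset.range n, (⨆ m : Fin (2 ^ (k + i + 1) + 1),
        |epochSum lo hi (fun t z => w t * residual (linkCells (k + i) m) z) ω|)
      + ⨆ m : Fin (2 ^ (k + n) + 1),
        epochSum lo hi (fun _ z => {p | cell (k + n) p = m}.indicator (fun _ => (1 : ℝ)) z.2) ω := by
  have h1 (n : ℕ) : |epochSum lo hi
      (fun t z => w t * residual (initialCells (k + n) (cell (k + n) a)) z) ω| ≤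
      (⨆ m : Fin (2 ^ k + 1),
        |epochSum lo hi (fun t z => w t * residual (initialCells k m) z) ω|)
      + ∑ i ∈ Finset.range n, (⨆ m : Fin (2 ^ (k + i + 1) + 1),
        |epochSum lo hi (fun t z => w t * residual (linkCells (k + i) m) z) ω|) := by
    induction n with
    | zero =>
      simp only [add_zero, Finset.range_zero, Finset.sum_empty]
      exact le_ciSup (f := fun m : Fin (2 ^ k + 1) =>
        |epochSum lo hi (fun t z => w t * residual (initialCells k m) z) ω|)
        (Set.finite_range _).bddAbove ⟨cell k a, cell_lt k a⟩
    | succ n ih =>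
      rw [Finset.sum_range_succ, ← add_assoc, ← add_assoc]
      simp only [residual_initialCells_succ, mul_add]
      rw [epochSum_add]
      refine (abs_add_le _ _).trans (add_le_add ih ?_)
      exact le_ciSup (f := fun m : Fin (2 ^ (k + n + 1) + 1) =>
        |epochSum lo hi (fun t z => w t * residual (linkCells (k + n) m) z) ω|)
        (Set.finite_range _).bddAbove ⟨cell (k + n + 1) a, cell_lt _ a⟩
  have h2 : epochSum lo hi (fun t z => w t * residual (Set.Iic a) z) ω =
      epochSum lo hi (fun t z => w t * residual (initialCells (k + n) (cell (k + n) a)) z) ω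
      + epochSum lo hi (fun t z => w t * (residual (Set.Iic a) z
        - residual (initialCells (k + n) (cell (k + n) a)) z)) ω := by
    rw [← epochSum_add]
    congr 1
    funext t z
    ring
  rw [h2]
  refine (abs_add_le _ _).trans (add_le_add (h1 n) ?_)
  refine (abs_epochSum_le_epochSum_abs _ _ _ _).trans ?_
  refine (epochSum_mono (fun t z => ?_) ω).trans
    (le_ciSup (f := fun m : Fin (2 ^ (k + n) + 1) => epochSum lo hi
      (fun _ z => {p | cell (k + n) p = m}.indicator (fun _ => (1 : ℝ)) z.2) ω)
      (Set.finite_range _).bddAbove ⟨cell (k + n) a, cell_lt _ a⟩)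
  rw [abs_mul]
  exact (mul_le_of_le_one_left (abs_nonneg _) (hw t)).trans (abs_residual_Iic_sub_le _ a z)

lemma log_le_log_two_mul {x : ℝ} (hx : 0 < x) {k : ℕ} (h : x ≤ 2 ^ k) :
    Real.log x ≤ Real.log 2 * k := by
  rw [mul_comm, ← Real.log_pow]
  exact Real.log_le_log hx h

/-- The step calibration error accrued in an epoch is dominated by a random variable with a small
integral over the event that the epoch is reached. -/
lemma exists_epoch_dominant (hP : IsSmoothed T c P) (hc : 0 < c) (hc1 : c ≤ 1)
    (hw : ∀ n, |w n| ≤ 1) (lo : ℝ) {hi : ℝ} (hhi : 0 ≤ hi) {k n : ℕ} (hk2 : 2 ≤ k)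
    (hk : 4 / c ^ 2 ≤ 2 ^ k) (hn : (T : ℝ) ≤ 2 ^ n) :
    ∃ Y : Transcript T → ℝ, Integrable Y (law P T) ∧
      (∀ (a : I) (ω : Transcript T),
        |epochSum lo hi (fun t z => w t * residual (Set.Iic a) z) ω| ≤ Y ω) ∧
      ∫ ω in {ω | lo ≤ realizedVar ω}, Y ω ∂law P T ≤
        (law P T).real {ω | lo ≤ realizedVar ω} *
          (20 * √((hi + 1 / 4) * (Real.log 2 * (k + 2)))
            + (3 * Real.log 2 * (n + 1) * (k + 2 + n) + 1 / 2 + Real.log 2 * (k + n + 1))) := by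
  have hl2 : 0 < Real.log 2 := Real.log_pos one_lt_two
  have hR : 0 < hi + 1 / 4 := by linarith
  set R := hi + 1 / 4
  set b := (law P T).real {ω : Transcript T | lo ≤ realizedVar ω}
  have hb : 0 ≤ b := measureReal_nonneg
  set A := Real.log 2 * ((k : ℝ) + 2)
  have hA : 0 < A := by positivity
  have hk' : (4 : ℝ) ≤ k + 2 := by
    have : (2 : ℝ) ≤ k := by exact_mod_cast hk2
    linarith
  have hc2 : 0 < c ^ 2 := by positivity
  have hi0 := integrable_iSup_epochSum_residual (T := T) (lo := lo) (hi := hi) P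
    (fun m : Fin (2 ^ k + 1) => measurableSet_initialCells k m) hw
  have hi1 (i : ℕ) := integrable_iSup_epochSum_residual (T := T) (lo := lo) (hi := hi) P
    (fun m : Fin (2 ^ (k + i + 1) + 1) => measurableSet_linkCells (k + i) m) hw
  have b0 := setIntegral_iSup_epochSum_le (T := T) (lo := lo) P hhi
    (fun m : Fin (2 ^ k + 1) => measurableSet_initialCells k m) hw (ρ := 1) (N := A)
    zero_le_one one_le_two
    (fun n hn x m => by
      rw [one_mul]
      exact integral_mono (integrable_bernVar.indicator (measurableSet_initialCells k m))
        integrable_bernVar fun p => Set.indicator_le_self' (fun p _ => bernVar_nonneg p) p)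
    hA (by
      have h1 : (1 : ℝ) ≤ 2 ^ k := one_le_pow₀ one_le_two
      have := log_le_log_two_mul (x := 2 * (2 ^ k + 1)) (k := k + 2) (by positivity)
        (by rw [pow_add]; linarith)
      simpa [A] using this)
  have b1 (i : ℕ) := setIntegral_iSup_epochSum_le (T := T) (lo := lo) P hhi
    (fun m : Fin (2 ^ (k + i + 1) + 1) => measurableSet_linkCells (k + i) m) hw (ρ := 1 / 2 ^ i)
    (N := Real.log 2 * (k + 2 + (i + 1)))
    (by positivity)
    (by
      rw [div_le_iff₀ (by positivity)]
      have : (1 : ℝ) ≤ 2 ^ i := one_le_pow₀ one_le_two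
      linarith)
    -- The fraction `4 · 2⁻⁽ᵏ⁺ⁱ⁾ / c²` is at most `2⁻ⁱ` by the choice of `k`.
    (fun n hn x m => by
      refine ((hP n hn x).integral_indicator_bernVar_le hc hc1 (measurableSet_linkCells (k + i) m)
        (by positivity) (volume_linkCells_le (k + i) m)).trans ?_
      refine mul_le_mul_of_nonneg_right ?_ (integral_nonneg fun p => bernVar_nonneg p)
      rw [pow_add]
      have h2i : (0 : ℝ) < 2 ^ i := by positivity
      rw [div_le_iff₀ hc2] at hk
      rw [div_le_div_iff₀ hc2 h2i]
      have : 4 * (1 / ((2 : ℝ) ^ k * 2 ^ i)) * 2 ^ i = 4 / 2 ^ k := by field_simp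
      rw [this, one_mul, div_le_iff₀ (by positivity)]
      linarith)
    (by positivity) (by
      have h1 : (1 : ℝ) ≤ 2 ^ (k + i + 1) := one_le_pow₀ one_le_two
      have := log_le_log_two_mul (x := 2 * (2 ^ (k + i + 1) + 1)) (k := k + i + 1 + 2)
        (by positivity) (by rw [pow_add _ _ 2]; linarith)
      simp only [Fintype.card_fin]
      push_cast at this ⊢
      linarith)
  obtain ⟨hi2, b2⟩ := setIntegral_iSup_epochCount_le (T := T) (lo := lo) (hi := hi) P
    (fun m : Fin (2 ^ (k + n) + 1) => measurableSet_cell (k + n) m) (q := 1 / 2 ^ (k + n) / c)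
    (N := Real.log 2 * (k + n + 1)) (by positivity)
    (fun n' hn' x m => (hP n' hn' x).measureReal_le hc (measurableSet_cell (k + n) m)
      (by positivity) (volume_cell_le (k + n) m))
    (by
      have h1 : (1 : ℝ) ≤ 2 ^ (k + n) := one_le_pow₀ one_le_two
      have := log_le_log_two_mul (x := 2 ^ (k + n) + 1) (k := k + n + 1)
        (by positivity) (by rw [pow_add _ _ 1]; linarith)
      simp only [Fintype.card_fin]
      push_cast at this ⊢
      linarith)
  -- Since `T ≤ 2 ^ n` and `2 ^ k * c ≥ 4`, this is twice an expected count of at most `1 / 4`.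
  have hcount : 2 * (T : ℝ) * (1 / 2 ^ (k + n) / c) ≤ 1 / 2 := by
    have h1 : 4 / c ≤ 2 ^ k := by
      refine le_trans ?_ hk
      refine div_le_div_of_nonneg_left (by norm_num) hc2 ?_
      nlinarith
    have h2 : 4 ≤ 2 ^ k * c := (div_le_iff₀ hc).1 h1
    rw [div_div, mul_one_div, pow_add, div_le_iff₀ (by positivity)]
    have := mul_le_mul h2 hn (by positivity) (by positivity)
    linarith
  -- The linear growth in `i` is absorbed by the ratio: `(4/5)² = (32/25) / 2`, and `(32/25) ^ i ≥ 1
  -- + 7i/25` by Bernoulli. The prefactor works as `(28/25)² ≥ 5/4` and `k + 2 ≥ 4`.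
  have hsqrt (i : ℕ) : √(1 / 2 ^ i * R * (Real.log 2 * (k + 2 + (i + 1)))) ≤
      √(R * A) * (28 / 25) * (4 / 5) ^ i := by
    refine Real.sqrt_le_iff.2 ⟨by positivity, ?_⟩
    rw [mul_pow, mul_pow, Real.sq_sqrt (by positivity), ← pow_mul, mul_comm i 2, pow_mul]
    have hbern := one_add_mul_le_pow (a := (7 / 25 : ℝ)) (by norm_num) i
    have h1 : (k : ℝ) + 2 + (i + 1) ≤ (k + 2) * (5 / 4 * (1 + i * (7 / 25))) := by
      have : (0 : ℝ) ≤ i := by positivity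
      nlinarith
    have h2 : ((4 / 5 : ℝ) ^ 2) ^ i = (1 + 7 / 25) ^ i * (1 / 2 ^ i) := by
      rw [← one_div_pow, ← mul_pow]; norm_num
    rw [h2]
    have h3 : (k : ℝ) + 2 + (i + 1) ≤ (k + 2) * ((28 / 25) ^ 2 * (1 + 7 / 25) ^ i) := by
      refine h1.trans (mul_le_mul_of_nonneg_left ?_ (by positivity))
      have : (0 : ℝ) < (1 + 7 / 25) ^ i := by positivity
      nlinarith
    have := mul_le_mul_of_nonneg_left h3 (by positivity : 0 ≤ 1 / 2 ^ i * R * Real.log 2)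
    simp only [A]
    linarith
  have hgeom : ∑ i ∈ Finset.range n, (4 / 5 : ℝ) ^ i ≤ 5 := by
    rw [geom_sum_eq (by norm_num)]
    have : (0 : ℝ) < (4 / 5) ^ n := by positivity
    rw [div_le_iff_of_neg (by norm_num)]
    linarith
  refine ⟨_, (hi0.add (integrable_finsetSum (Finset.range n) fun i _ => hi1 i)).add hi2,
    fun a ω => ?_, ?_⟩
  · have := abs_epochSum_Iic_le hw lo hi k n a ω
    simpa using this
  · rw [integral_add' (hi0.add (integrable_finsetSum _ fun i _ => hi1 i)).integrableOn
      hi2.integrableOn, integral_add' hi0.integrableOn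
      (integrable_finsetSum _ fun i _ => hi1 i).integrableOn,
      integral_finsetSum _ fun i _ => (hi1 i).integrableOn]
    -- The constant is `3 · (28/25) · 5 ≤ 17`; the coarsest level adds `3`, which gives `20`.
    have s1 : ∑ i ∈ Finset.range n, ∫ ω in {ω | lo ≤ realizedVar ω},
        (⨆ m : Fin (2 ^ (k + i + 1) + 1),
          |epochSum lo hi (fun t z => w t * residual (linkCells (k + i) m) z) ω|) ∂law P T
        ≤ b * (17 * √(R * A) + 3 * (n * (Real.log 2 * (k + 2 + n)))) := by
      calc _ ≤ ∑ i ∈ Finset.range n, b * (3 * (√(R * A) * (28 / 25) * (4 / 5) ^ i)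
            + 3 * (Real.log 2 * (k + 2 + n))) := by
            refine Finset.sum_le_sum fun i hi' => (b1 i).trans ?_
            have hin : (i : ℝ) + 1 ≤ n := by exact_mod_cast Finset.mem_range.1 hi'
            refine mul_le_mul_of_nonneg_left ?_ hb
            have := hsqrt i
            gcongr
        _ = b * (3 * (√(R * A) * (28 / 25)) * ∑ i ∈ Finset.range n, (4 / 5 : ℝ) ^ i
            + 3 * (n * (Real.log 2 * (k + 2 + n)))) := by
            rw [← Finset.mul_sum, Finset.sum_add_distrib, Finset.mul_sum]
            simp only [Finset.sum_const, Finset.card_range, nsmul_eq_mul]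
            congr 2
            · exact Finset.sum_congr rfl fun i _ => by ring
            · ring
        _ ≤ _ := by
            refine mul_le_mul_of_nonneg_left ?_ hb
            have h0 := Real.sqrt_nonneg (R * A)
            have := mul_le_mul_of_nonneg_left hgeom
              (by positivity : 0 ≤ 3 * (√(R * A) * (28 / 25)))
            linarith
    rw [one_mul] at b0
    have s2 : b * (2 * T * (1 / 2 ^ (k + n) / c) + Real.log 2 * (k + n + 1)) ≤
        b * (1 / 2 + Real.log 2 * (k + n + 1)) :=
      mul_le_mul_of_nonneg_left (by linarith) hb
    refine (add_le_add (add_le_add b0 s1) (b2.trans s2)).trans ?_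
    have hn0 : (0 : ℝ) ≤ n := by positivity
    have hA' : A ≤ Real.log 2 * (k + 2 + n) := by
      have := mul_nonneg hl2.le hn0
      simp only [A]; linarith
    rw [← mul_add, ← mul_add]
    refine mul_le_mul_of_nonneg_left ?_ hb
    linarith

end

/-! ### The error of the truthful forecaster -/

/-- The thresholds of the realized variance that separate the epochs: `0, 1, 4, 16, …`. -/
def epochStart : ℕ → ℝ
  | 0 => 0
  | j + 1 => 4 ^ j

lemma epochStart_nonneg (j : ℕ) : 0 ≤ epochStart j := by
  cases j <;> simp [epochStart]

lemma epochStart_le_succ (j : ℕ) : epochStart j ≤ epochStart (j + 1) := by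
  cases j with
  | zero => simp [epochStart]
  | succ j => simp only [epochStart]; exact pow_le_pow_right₀ (by norm_num) (by omega)

lemma sum_ite_mem_epoch {V : ℝ} (hV : 0 ≤ V) (a : ℝ) (m : ℕ) (hm : V < epochStart m) :
    ∑ j ∈ Finset.range m,
      (open Classical in if V ∈ Set.Ico (epochStart j) (epochStart (j + 1)) then a else 0) = a := by
  induction m with
  | zero => exact absurd hm (not_lt.2 hV)
  | succ m ih =>
    rw [Finset.sum_range_succ]
    by_cases h : V < epochStart m
    · rw [ih h, if_neg fun hc => absurd hc.1 (not_le.2 h), add_zero]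
    · rw [if_pos ⟨not_lt.1 h, hm⟩, Finset.sum_eq_zero, zero_add]
      intro j hj
      refine if_neg fun hc => h (hc.2.trans_le ?_)
      exact monotone_nat_of_le_succ epochStart_le_succ (Finset.mem_range.1 hj)

lemma sum_epochSum {T m : ℕ} (F : ℕ → Bool × I → ℝ) (ω : Transcript T)
    (hm : realizedVar ω < epochStart m) :
    ∑ j ∈ Finset.range m, epochSum (epochStart j) (epochStart (j + 1)) F ω =
      ∑ t : Fin T, F t (ω t) := by
  unfold epochSum
  rw [Finset.sum_comm]
  exact Finset.sum_congr rfl fun t _ => sum_ite_mem_epoch (realizedVar_nonneg _) _ m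
    ((realizedVar_pre_le ω t).trans_lt hm)

/-- A geometric sum dominated by its last term: if epoch `j + 1` is reached then `2 ^ j ≤ √V`, and
the powers up to `2 ^ (j + 1)` sum to less than `4 · 2 ^ j`. The `1` accounts for epoch `0`, always
reached when `V ≥ 0`. -/
lemma sum_two_pow_epoch_le {V : ℝ} (m : ℕ) :
    ∑ j ∈ Finset.range (m + 1), (open Classical in if epochStart j ≤ V then (2 : ℝ) ^ j else 0) ≤
      1 + 4 * √V := by
  classical
  induction m with
  | zero =>
    have := Real.sqrt_nonneg V
    simp only [zero_add, Finset.range_one, Finset.sum_singleton, pow_zero]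
    split_ifs <;> linarith
  | succ m ih =>
    by_cases h : epochStart (m + 1) ≤ V
    · have h1 : (2 : ℝ) ^ m ≤ √V := by
        refine Real.le_sqrt_of_sq_le (le_trans (le_of_eq ?_) h)
        rw [← pow_mul, mul_comm, pow_mul]
        norm_num [epochStart]
      have h2 : ∑ j ∈ Finset.range (m + 1 + 1), (if epochStart j ≤ V then (2 : ℝ) ^ j else 0) ≤
          ∑ j ∈ Finset.range (m + 1 + 1), (2 : ℝ) ^ j :=
        Finset.sum_le_sum fun j _ => by split_ifs; exacts [le_rfl, by positivity]
      rw [geom_sum_eq (by norm_num), pow_add, pow_add] at h2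
      linarith
    · rw [Finset.sum_range_succ, if_neg h, add_zero]
      exact ih

/-- The indicator of a set of time steps. -/
def timeWeight {T : ℕ} (S : Finset (Fin T)) (n : ℕ) : ℝ :=
  open Classical in if ∃ h : n < T, (⟨n, h⟩ : Fin T) ∈ S then 1 else 0

lemma abs_timeWeight_le {T : ℕ} (S : Finset (Fin T)) (n : ℕ) : |timeWeight S n| ≤ 1 := by
  unfold timeWeight; split_ifs <;> simp

lemma timeWeight_coe {T : ℕ} (S : Finset (Fin T)) (t : Fin T) :
    timeWeight S t = if t ∈ S then 1 else 0 := by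
  simp [timeWeight]

lemma stepSum_eq_sum_residual {T : ℕ} (S : Finset (Fin T)) (ω : Transcript T) (a : I) :
    ∑ t, (bit (outcomes ω t) - (condProbs ω t : ℝ)) *
        (if condProbs ω t ≤ a ∧ t ∈ S then 1 else 0) =
      ∑ t : Fin T, timeWeight S t * residual (Set.Iic a) (ω t) := by
  refine Finset.sum_congr rfl fun t _ => ?_
  rw [timeWeight_coe]
  by_cases h1 : (ω t).2 ≤ a <;> by_cases h2 : t ∈ S <;>
    simp [residual, outcomes, condProbs, h1, h2]

lemma integrable_stepCEOn {T : ℕ} (P : Nature) (S : Finset (Fin T)) :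
    Integrable (fun ω : Transcript T => stepCEOn S (outcomes ω) (condProbs ω)) (law P T) := by
  refine Integrable.of_bound (C := (T : ℝ)) ?_ ?_
  · exact ((measurable_stepCEOn S).comp
      (measurable_outcomes.prodMk measurable_condProbs)).aestronglyMeasurable
  · refine Filter.Eventually.of_forall fun ω => ?_
    rw [Real.norm_of_nonneg (stepCEOn_nonneg _ _ _)]
    exact stepCEOn_le _ _ _

section

variable {T : ℕ} {c : ℝ} {P : Nature}

lemma integral_stepCEOn_le (hP : IsSmoothed T c P) (hc : 0 < c) (hc1 : c ≤ 1)
    (S : Finset (Fin T)) {k n m : ℕ} (hk2 : 2 ≤ k) (hk : 4 / c ^ 2 ≤ 2 ^ k)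
    (hn : (T : ℝ) ≤ 2 ^ n) (hm : (T : ℝ) < 4 ^ (m + 1)) :
    ∫ ω, stepCEOn S (outcomes ω) (condProbs ω) ∂law P T ≤
      23 * √(Real.log 2 * (k + 2)) * (1 + 4 * expSqrtVar T P)
        + (m + 1) * (3 * Real.log 2 * (n + 1) * (k + 2 + n) + 1 / 2
          + Real.log 2 * (k + n + 1)) := by
  classical
  have hl2 : 0 < Real.log 2 := Real.log_pos one_lt_two
  set A := Real.log 2 * ((k : ℝ) + 2)
  set E := 3 * Real.log 2 * (n + 1) * (k + 2 + n) + 1 / 2 + Real.log 2 * (k + n + 1)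
  have hE : 0 ≤ E := by positivity
  let B : ℕ → Set (Transcript T) := fun j => {ω | epochStart j ≤ realizedVar ω}
  have hB (j : ℕ) : MeasurableSet (B j) := measurableSet_le_realizedVar T _
  choose Y hYi hY hYb using fun j : ℕ => exists_epoch_dominant hP hc hc1 (abs_timeWeight_le S)
    (epochStart j) (epochStart_nonneg (j + 1)) hk2 hk hn
  -- The variance is at most `T / 4 < 4 ^ m`, so `m + 1` epochs exhaust all rounds.
  have hlast (ω : Transcript T) : realizedVar ω < epochStart (m + 1) := by
    refine (realizedVar_le ω).trans_lt ?_
    simp only [epochStart]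
    rw [pow_succ] at hm
    linarith
  have hpt (ω : Transcript T) : stepCEOn S (outcomes ω) (condProbs ω) ≤
      ∑ j ∈ Finset.range (m + 1), (B j).indicator (Y j) ω := by
    refine ciSup_le fun a => ?_
    rw [stepSum_eq_sum_residual, ← sum_epochSum (fun t z => timeWeight S t *
      residual (Set.Iic a) z) ω (hlast ω)]
    refine (Finset.abs_sum_le_sum_abs _ _).trans (Finset.sum_le_sum fun j _ => ?_)
    by_cases hω : ω ∈ B j
    · rw [Set.indicator_of_mem hω]
      exact hY j a ω
    · rw [Set.indicator_of_notMem hω, epochSum_eq_zero _ (not_le.1 hω), abs_zero]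
  have h1 : ∫ ω, stepCEOn S (outcomes ω) (condProbs ω) ∂law P T ≤
      ∑ j ∈ Finset.range (m + 1), ∫ ω in B j, Y j ω ∂law P T := by
    refine (integral_mono (integrable_stepCEOn P S) (integrable_finsetSum _ fun j _ =>
      (hYi j).indicator (hB j)) hpt).trans (le_of_eq ?_)
    rw [integral_finsetSum _ fun j _ => (hYi j).indicator (hB j)]
    exact Finset.sum_congr rfl fun j _ => integral_indicator (hB j)
  have hsqrt (j : ℕ) : √((epochStart (j + 1) + 1 / 4) * A) ≤ 23 / 20 * 2 ^ j * √A := by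
    rw [Real.sqrt_mul (by linarith [epochStart_nonneg (j + 1)])]
    refine mul_le_mul_of_nonneg_right ?_ (Real.sqrt_nonneg _)
    refine Real.sqrt_le_iff.2 ⟨by positivity, ?_⟩
    simp only [epochStart]
    have : (1 : ℝ) ≤ 4 ^ j := one_le_pow₀ (by norm_num)
    rw [mul_pow, ← pow_mul, mul_comm j 2, pow_mul]
    norm_num
    linarith
  -- The probability of reaching the epoch is kept in the leading term and bounded by one in the
  -- logarithmic term; `20 · (23/20) = 23`.
  have h2 (j : ℕ) : ∫ ω in B j, Y j ω ∂law P T ≤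
      23 * √A * ((law P T).real (B j) * 2 ^ j) + E := by
    have hYb' : ∫ ω in B j, Y j ω ∂law P T ≤
        (law P T).real (B j) * (20 * √((epochStart (j + 1) + 1 / 4) * A) + E) := hYb j
    refine hYb'.trans ?_
    have hb0 : 0 ≤ (law P T).real (B j) := measureReal_nonneg
    have hb1 : (law P T).real (B j) ≤ 1 := measureReal_le_one
    have := mul_le_mul_of_nonneg_left (hsqrt j) hb0
    have := mul_le_mul_of_nonneg_right hb1 hE
    linarith
  have h3 : ∑ j ∈ Finset.range (m + 1), (law P T).real (B j) * 2 ^ j ≤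
      1 + 4 * expSqrtVar T P := by
    have hi : Integrable (fun ω : Transcript T => 1 + 4 * √(realizedVar ω)) (law P T) :=
      (integrable_const _).add ((integrable_sqrt_realizedVar P T).const_mul 4)
    have hj (j : ℕ) : Integrable ((B j).indicator fun _ => (2 : ℝ) ^ j) (law P T) :=
      (integrable_const _).indicator (hB j)
    have := integral_mono (integrable_finsetSum (Finset.range (m + 1)) fun j _ => hj j) hi
      fun ω => sum_two_pow_epoch_le (V := realizedVar ω) m
    rw [integral_finsetSum _ fun j _ => hj j, integral_add (integrable_const _)
      ((integrable_sqrt_realizedVar P T).const_mul 4), integral_const_mul] at this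
    simp only [integral_indicator_const _ (hB _), smul_eq_mul, integral_const, probReal_univ,
      mul_one] at this
    exact this
  calc _ ≤ ∑ j ∈ Finset.range (m + 1), (23 * √A * ((law P T).real (B j) * 2 ^ j) + E) :=
        h1.trans (Finset.sum_le_sum fun j _ => h2 j)
    _ = 23 * √A * ∑ j ∈ Finset.range (m + 1), (law P T).real (B j) * 2 ^ j + (m + 1) * E := by
        rw [Finset.sum_add_distrib, Finset.mul_sum]
        simp
    _ ≤ _ := by gcongr

lemma expSqrtVar_nonneg (T : ℕ) (P : Nature) : 0 ≤ expSqrtVar T P :=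
  integral_nonneg fun _ => Real.sqrt_nonneg _

lemma err_stepCEsub_eq (P : Nature) (A : Forecaster) :
    err (T := T) stepCEsub P A =
      ∫ ω, (∑ S : Finset (Fin T), stepCEOn S (outcomes ω) (A.predictions ω)) / 2 ^ T ∂law P T := rfl

lemma err_truthful_le_of_forall {b : ℝ}
    (h : ∀ S : Finset (Fin T), ∫ ω, stepCEOn S (outcomes ω) (condProbs ω) ∂law P T ≤ b) :
    err (T := T) stepCEsub P truthful ≤ b := by
  have : err (T := T) stepCEsub P truthful =
      (∑ S : Finset (Fin T), ∫ ω, stepCEOn S (outcomes ω) (condProbs ω) ∂law P T) / 2 ^ T := by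
    rw [err_stepCEsub_eq, integral_div,
      ← integral_finsetSum _ fun S _ => integrable_stepCEOn P S]
    rfl
  rw [this, div_le_iff₀ (by positivity)]
  refine (Finset.sum_le_sum fun S _ => h S).trans (le_of_eq ?_)
  simp [mul_comm]

lemma truthful_poly_le {L d : ℝ} (hL : 1 ≤ L) (hd : 0 ≤ d) :
    23 * (3 / 2 * ((1 + d) / 2) + 19 / 10) + (L / 2 + 1) *
      (52 / 25 * ((L + 2) * (2 * d + L + 6)) + 1 / 2 + 7 / 10 * (2 * d + L + 5)) ≤
      (L + 3) * (16 * L * (L + d) + 15) + 24 := by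
  -- In the variables `u, d ≥ 0` the inequality holds by comparing coefficients of monomials.
  obtain ⟨u, rfl⟩ : ∃ u, L = 1 + u := ⟨L - 1, by ring⟩
  have hu0 : 0 ≤ u := by linarith
  have : 0 ≤ u * d := by positivity
  have : 0 ≤ u ^ 2 * d := by positivity
  have : 0 ≤ u ^ 2 := by positivity
  have : 0 ≤ u ^ 3 := by positivity
  linarith

lemma truthful_bound_arith {L d V k n m : ℝ} (hL : 1 ≤ L) (hd : 0 ≤ d) (hV : 0 ≤ V)
    (hk0 : 0 ≤ k) (hn0 : 0 ≤ n) (hk : k ≤ 2 * d + 3) (hn : n ≤ L + 1)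
    (hm : m ≤ L / 2) :
    23 * √(Real.log 2 * (k + 2)) * (1 + 4 * V)
        + (m + 1) * (3 * Real.log 2 * (n + 1) * (k + 2 + n) + 1 / 2
          + Real.log 2 * (k + n + 1)) ≤
      (547 * √(Real.log 2 * d) + 1161) * V + (L + 3) * (16 * L * (L + d) + 15)
        + 8 * (√2 * √(Real.log 2 * d)) + 17 * √2 := by
  have hl2 : 0 < Real.log 2 := Real.log_pos one_lt_two
  have hl2' : Real.log 2 < 0.6931471808 := Real.log_two_lt_d9
  set s := √(Real.log 2 * d)
  have hs0 : 0 ≤ s := Real.sqrt_nonneg _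
  have hs2 : s ^ 2 = Real.log 2 * d := Real.sq_sqrt (by positivity)
  have hA : √(Real.log 2 * (k + 2)) ≤ 3 / 2 * s + 19 / 10 := by
    refine Real.sqrt_le_iff.2 ⟨by positivity, ?_⟩
    have := mul_le_mul_of_nonneg_left hk hl2.le
    nlinarith
  -- The part of the leading term without `V` is moved into the polylogarithmic term.
  have hsd : s ≤ (1 + d) / 2 := by nlinarith [sq_nonneg (s - 1)]
  have h17 : 24 ≤ 17 * √2 := by
    have : (24 / 17 : ℝ) ≤ √2 := Real.le_sqrt_of_sq_le (by norm_num)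
    linarith
  have h8 : 0 ≤ 8 * (√2 * s) := by positivity
  have hE : 3 * Real.log 2 * (n + 1) * (k + 2 + n) + 1 / 2 + Real.log 2 * (k + n + 1) ≤
      52 / 25 * ((L + 2) * (2 * d + L + 6)) + 1 / 2 + 7 / 10 * (2 * d + L + 5) := by
    have h1 : (n + 1) * (k + 2 + n) ≤ (L + 2) * (2 * d + L + 6) :=
      mul_le_mul (by linarith) (by linarith) (by positivity) (by linarith)
    have h2 : 3 * Real.log 2 * ((n + 1) * (k + 2 + n)) ≤
        52 / 25 * ((L + 2) * (2 * d + L + 6)) :=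
      mul_le_mul (by linarith) h1 (by positivity) (by positivity)
    have h3 : Real.log 2 * (k + n + 1) ≤ 7 / 10 * (2 * d + L + 5) :=
      mul_le_mul (by linarith) (by linarith) (by positivity) (by positivity)
    linarith
  have hmE := mul_le_mul (by linarith : m + 1 ≤ L / 2 + 1) hE (by positivity) (by positivity)
  have hlead := mul_le_mul_of_nonneg_right (mul_le_mul_of_nonneg_left hA
    (by norm_num : (0 : ℝ) ≤ 23)) (by positivity : 0 ≤ 1 + 4 * V)
  have hsV : 0 ≤ s * V := by positivity
  have hpoly := truthful_poly_le hL hd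
  have h5 : 23 * (3 / 2 * s + 19 / 10) * (1 + 4 * V) ≤
      (547 * s + 1161) * V + 23 * (3 / 2 * ((1 + d) / 2) + 19 / 10) := by linarith
  linarith

theorem err_truthful_le (hT : 2 ≤ T) (hc : 0 < c) (hc1 : c ≤ 1) (hP : IsSmoothed T c P) :
    err (T := T) stepCEsub P truthful ≤
      (547 * √(Real.log (1 / c)) + 1161) * expSqrtVar T P
        + (Real.logb 2 T + 3) * (16 * Real.logb 2 T * Real.logb 2 (T / c) + 15)
        + 8 * √(2 * Real.log (1 / c)) + 17 * √2 := by
  have hT0 : (0 : ℝ) < T := by positivity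
  set L := Real.logb 2 T with hL
  set d := Real.logb 2 (1 / c) with hd
  have hTL : (2 : ℝ) ^ L = T := Real.rpow_logb (by norm_num) (by norm_num) hT0
  have hcd : (2 : ℝ) ^ d = 1 / c := Real.rpow_logb (by norm_num) (by norm_num) (by positivity)
  have hLd : Real.logb 2 (T / c) = L + d := by
    rw [hL, hd, ← Real.logb_mul hT0.ne' (by positivity)]
    congr 1
    ring
  have hL1 : 1 ≤ L := by
    rw [hL, Real.le_logb_iff_rpow_le one_lt_two hT0]
    simpa using (by exact_mod_cast hT : (2 : ℝ) ≤ T)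
  have hd0 : 0 ≤ d := Real.logb_nonneg one_lt_two (by rw [le_div_iff₀ hc]; linarith)
  have hlogd : Real.log (1 / c) = Real.log 2 * d := by
    rw [hd, Real.logb]; field_simp
  -- The coarse mesh has `2 ^ k ≥ 4 / c²`, there are `n` levels with `2 ^ n ≥ T`, and `m + 1` epochs
  -- with `4 ^ (m + 1) > T`.
  set k := ⌈2 * d⌉₊ + 2
  set n := ⌈L⌉₊
  set m := ⌊L / 2⌋₊
  have hk : (k : ℝ) ≤ 2 * d + 3 := by
    have := (Nat.ceil_lt_add_one (by positivity : 0 ≤ 2 * d)).le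
    simp only [k]; push_cast; linarith
  have hn : (n : ℝ) ≤ L + 1 := (Nat.ceil_lt_add_one (by linarith)).le
  have hm : (m : ℝ) ≤ L / 2 := Nat.floor_le (by linarith)
  have hk4 : 4 / c ^ 2 ≤ (2 : ℝ) ^ k := by
    have h1 : (2 : ℝ) ^ (2 * d) ≤ 2 ^ ⌈2 * d⌉₊ := by
      rw [← Real.rpow_natCast]
      exact Real.rpow_le_rpow_of_exponent_le one_le_two (Nat.le_ceil _)
    have h2 : (2 : ℝ) ^ (2 * d) = (1 / c) ^ 2 := by
      rw [mul_comm, Real.rpow_mul (by norm_num), hcd, Real.rpow_two]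
    rw [h2] at h1
    calc 4 / c ^ 2 = (1 / c) ^ 2 * 2 ^ 2 := by ring
      _ ≤ 2 ^ k := by
        simp only [k]
        rw [pow_add]
        gcongr
  have hTn : (T : ℝ) ≤ 2 ^ n := by
    rw [← hTL, ← Real.rpow_natCast]
    exact Real.rpow_le_rpow_of_exponent_le one_le_two (Nat.le_ceil _)
  have hTm : (T : ℝ) < 4 ^ (m + 1) := by
    have h4 : (4 : ℝ) ^ (m + 1) = 2 ^ (2 * ((m : ℝ) + 1)) := by
      rw [Real.rpow_mul (by norm_num)]
      norm_num
      rw [← Real.rpow_natCast]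
      norm_num
    rw [← hTL, h4]
    refine Real.rpow_lt_rpow_of_exponent_lt one_lt_two ?_
    linarith [Nat.lt_floor_add_one (L / 2)]
  refine err_truthful_le_of_forall fun S =>
    (integral_stepCEOn_le hP hc hc1 S (by omega) hk4 hTn hTm).trans ?_
  rw [hLd, Real.sqrt_mul zero_le_two, hlogd]
  have hV := expSqrtVar_nonneg T P
  exact truthful_bound_arith hL1 hd0 hV (by positivity) (by positivity) hk hn hm

end

/-! ### Random signs and random subsets -/

section

variable {ι : Type*} [DecidableEq ι] (a : ι → ℝ)

/-- The sum of `± a t` over `t ∈ s`, with positive signs on `S`. -/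
def signSum (s S : Finset ι) : ℝ := ∑ t ∈ s, if t ∈ S then a t else -a t

lemma sum_powerset_insert_signSum (f : ℝ → ℝ) {i : ι} {s : Finset ι} (hi : i ∉ s) :
    ∑ S ∈ (insert i s).powerset, f (signSum a (insert i s) S) =
      ∑ S ∈ s.powerset, (f (signSum a s S - a i) + f (signSum a s S + a i)) := by
  rw [Finset.sum_powerset_insert hi, ← Finset.sum_add_distrib]
  refine Finset.sum_congr rfl fun S hS => ?_
  have hiS : i ∉ S := fun h => hi (Finset.mem_powerset.1 hS h)
  congr 2
  · simp [signSum, Finset.sum_insert hi, hiS]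
    ring
  · simp only [signSum, Finset.sum_insert hi, Finset.mem_insert_self, if_true]
    rw [add_comm]
    congr 1
    refine Finset.sum_congr rfl fun t ht => ?_
    have : t ≠ i := fun h => hi (h ▸ ht)
    simp [this]

lemma sum_signSum_sq (s : Finset ι) :
    ∑ S ∈ s.powerset, signSum a s S ^ 2 = 2 ^ s.card * ∑ t ∈ s, a t ^ 2 := by
  induction s using Finset.induction_on with
  | empty => simp [signSum]
  | insert i s hi ih =>
    rw [sum_powerset_insert_signSum a (· ^ 2) hi, Finset.sum_insert hi,
      Finset.card_insert_of_notMem hi]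
    have h (z : ℝ) : (z - a i) ^ 2 + (z + a i) ^ 2 = 2 * z ^ 2 + 2 * a i ^ 2 := by ring
    simp only [h, Finset.sum_add_distrib, ← Finset.mul_sum, ih, Finset.sum_const,
      Finset.card_powerset, nsmul_eq_mul, Nat.cast_pow, Nat.cast_ofNat]
    ring

lemma sum_signSum_pow_four_le (s : Finset ι) :
    ∑ S ∈ s.powerset, signSum a s S ^ 4 ≤ 3 * 2 ^ s.card * (∑ t ∈ s, a t ^ 2) ^ 2 := by
  induction s using Finset.induction_on with
  | empty => simp [signSum]
  | insert i s hi ih =>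
    rw [sum_powerset_insert_signSum a (· ^ 4) hi, Finset.sum_insert hi,
      Finset.card_insert_of_notMem hi]
    have h (z : ℝ) : (z - a i) ^ 4 + (z + a i) ^ 4 =
        2 * z ^ 4 + 12 * a i ^ 2 * z ^ 2 + 2 * a i ^ 4 := by ring
    simp only [h, Finset.sum_add_distrib, ← Finset.mul_sum, sum_signSum_sq, Finset.sum_const,
      Finset.card_powerset, nsmul_eq_mul, Nat.cast_pow, Nat.cast_ofNat]
    have : 0 ≤ 2 ^ s.card * a i ^ 4 := by positivity
    rw [pow_succ (2 : ℝ)]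
    linarith

/-- A Khintchine inequality. -/
lemma sqrt_le_sum_abs_signSum (s : Finset ι) :
    2 ^ s.card * (5 / 9 * √(∑ t ∈ s, a t ^ 2)) ≤ ∑ S ∈ s.powerset, |signSum a s S| := by
  have hs0 : 0 ≤ ∑ t ∈ s, a t ^ 2 := Finset.sum_nonneg fun t _ => sq_nonneg _
  rcases hs0.eq_or_lt with h0 | hpos
  · rw [← h0]
    simpa using Finset.sum_nonneg fun S _ => abs_nonneg (signSum a s S)
  set r := √(∑ t ∈ s, a t ^ 2)
  have hr : 0 < r := Real.sqrt_pos.2 hpos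
  have hr2 : r ^ 2 = ∑ t ∈ s, a t ^ 2 := Real.sq_sqrt hs0
  -- The two sides touch at `|z| = 3r/2`. With second moment `r²` and fourth moment at most `3r⁴`,
  -- averaging gives `1 - 3 · 4/27 = 5/9`.
  have hpt (z : ℝ) : r ^ 2 * z ^ 2 - 4 / 27 * z ^ 4 ≤ r ^ 3 * |z| := by
    have h2 : z ^ 2 = |z| ^ 2 := (sq_abs z).symm
    have h4 : z ^ 4 = |z| ^ 4 := by rw [← abs_pow]; exact (abs_of_nonneg (by positivity)).symm
    rw [h2, h4]
    have hz := abs_nonneg z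
    set u := |z|
    have : 0 ≤ u * ((2 * u - 3 * r) ^ 2 * (u + 3 * r)) := by positivity
    nlinarith
  have h1 : r ^ 2 * ∑ S ∈ s.powerset, signSum a s S ^ 2
      - 4 / 27 * ∑ S ∈ s.powerset, signSum a s S ^ 4 ≤ r ^ 3 * ∑ S ∈ s.powerset, |signSum a s S| := by
    rw [Finset.mul_sum, Finset.mul_sum, Finset.mul_sum, ← Finset.sum_sub_distrib]
    exact Finset.sum_le_sum fun S _ => hpt _
  have h4 := sum_signSum_pow_four_le a s
  rw [sum_signSum_sq, ← hr2] at h1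
  rw [← hr2] at h4
  have h3 : r ^ 3 * (2 ^ s.card * (5 / 9 * r)) ≤ r ^ 3 * ∑ S ∈ s.powerset, |signSum a s S| := by
    linarith
  exact le_of_mul_le_mul_left h3 (by positivity)

end

/-- The subset sums over `S` and `Sᶜ` differ by the sign sum of `S`, so the triangle inequality and
the symmetry under complement reduce this to Khintchine at the cost of a factor two. -/
lemma sqrt_le_sum_abs_subset_sum {T : ℕ} (a : Fin T → ℝ) :
    2 ^ T * (5 / 18 * √(∑ t, a t ^ 2)) ≤
      ∑ S : Finset (Fin T), |∑ t, a t * (if t ∈ S then 1 else 0)| := by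
  have hK := sqrt_le_sum_abs_signSum a Finset.univ
  rw [Finset.powerset_univ, Finset.card_univ, Fintype.card_fin] at hK
  have h1 (S : Finset (Fin T)) : ∑ t, a t * (if t ∈ S then 1 else 0) =
      ((∑ t, a t) + signSum a Finset.univ S) / 2 := by
    rw [signSum, ← Finset.sum_add_distrib, Finset.sum_div]
    refine Finset.sum_congr rfl fun t _ => ?_
    split_ifs <;> ring
  have h2 (S : Finset (Fin T)) : signSum a Finset.univ Sᶜ = -signSum a Finset.univ S := by
    rw [signSum, signSum, ← Finset.sum_neg_distrib]
    refine Finset.sum_congr rfl fun t _ => ?_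
    by_cases h : t ∈ S <;> simp [h]
  have h3 : ∑ S : Finset (Fin T), |∑ t, a t * (if t ∈ S then 1 else 0)| =
      ∑ S : Finset (Fin T), |∑ t, a t * (if t ∈ Sᶜ then 1 else 0)| :=
    (Equiv.sum_comp (compl_involutive (α := Finset (Fin T))).toPerm
      fun S : Finset (Fin T) => |∑ t, a t * (if t ∈ S then 1 else 0)|).symm
  have h4 : ∑ S : Finset (Fin T), |signSum a Finset.univ S| ≤
      ∑ S : Finset (Fin T), |∑ t, a t * (if t ∈ S then 1 else 0)| +
        ∑ S : Finset (Fin T), |∑ t, a t * (if t ∈ Sᶜ then 1 else 0)| := by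
    rw [← Finset.sum_add_distrib]
    refine Finset.sum_le_sum fun S _ => ?_
    rw [h1, h1, h2]
    refine le_trans (le_of_eq ?_) (abs_sub _ _)
    congr 1
    ring
  rw [← h3] at h4
  linarith

/-- Only the threshold `α = 1`, which admits every prediction, is used. -/
lemma sqrt_le_stepCEsub {T : ℕ} (x : Fin T → Bool) (p : Fin T → I) :
    5 / 18 * √(∑ t, (bit (x t) - (p t : ℝ)) ^ 2) ≤ stepCEsub x p := by
  unfold stepCEsub
  rw [le_div_iff₀ (by positivity), mul_comm]
  refine (sqrt_le_sum_abs_subset_sum fun t => bit (x t) - (p t : ℝ)).trans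
    (Finset.sum_le_sum fun S _ => ?_)
  refine le_trans (le_of_eq ?_) (le_ciSup (f := fun α : I => |∑ t, (bit (x t) - (p t : ℝ)) *
    (if p t ≤ α ∧ t ∈ S then 1 else 0)|)
    ⟨T, by rintro _ ⟨α, rfl⟩; exact abs_stepSum_le S x p α⟩ 1)
  simp [unitInterval.le_one']

/-! ### Every forecaster pays for the realized variance -/

lemma lintegral_roundLaw_exp_le_one (μ : Measure I) [IsProbabilityMeasure μ]
    {F : Bool × I → ℝ} (hF : Measurable F)
    (h : ∀ p : I, (p : ℝ) * Real.exp (F (true, p)) + (1 - p) * Real.exp (F (false, p)) ≤ 1) :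
    ∫⁻ z, ENNReal.ofReal (Real.exp (F z)) ∂roundLaw μ ≤ 1 := by
  rw [lintegral_roundLaw μ hF.exp.ennreal_ofReal]
  refine (lintegral_mono (g := fun _ => 1) fun p => ?_).trans (by simp)
  have h1 : 0 ≤ 1 - (p : ℝ) := by linarith [p.2.2]
  rw [← ENNReal.ofReal_mul p.2.1, ← ENNReal.ofReal_mul h1,
    ← ENNReal.ofReal_add (mul_nonneg p.2.1 (Real.exp_pos _).le)
      (mul_nonneg h1 (Real.exp_pos _).le)]
  exact ENNReal.ofReal_le_one.2 (h p)

/-- The mean square loss is `p (1 - p) + (p - q)²`, at least the variance; `exp (-y) ≤ 1 - y / 2`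
costs the factor `1 / 2`. -/
lemma bernoulli_exp_sq_loss_le_one {p q : ℝ} (hp0 : 0 ≤ p) (hp1 : p ≤ 1) (hq0 : 0 ≤ q)
    (hq1 : q ≤ 1) :
    p * Real.exp (p * (1 - p) / 2 - (1 - q) ^ 2)
      + (1 - p) * Real.exp (p * (1 - p) / 2 - (0 - q) ^ 2) ≤ 1 := by
  have h1 := exp_neg_le (sq_nonneg (1 - q)) (by nlinarith)
  have h0 := exp_neg_le (sq_nonneg (0 - q)) (by nlinarith)
  have hsum : p * Real.exp (-(1 - q) ^ 2) + (1 - p) * Real.exp (-(0 - q) ^ 2) ≤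
      1 - p * (1 - p) / 2 := by
    have := add_le_add (mul_le_mul_of_nonneg_left h1 hp0)
      (mul_le_mul_of_nonneg_left h0 (by linarith : 0 ≤ 1 - p))
    nlinarith [sq_nonneg (p - q)]
  have he : 1 - p * (1 - p) / 2 ≤ Real.exp (-(p * (1 - p) / 2)) := by
    linarith [Real.add_one_le_exp (-(p * (1 - p) / 2))]
  simp only [sub_eq_add_neg (p * (1 - p) / 2), Real.exp_add]
  calc _ = Real.exp (p * (1 - p) / 2)
        * (p * Real.exp (-(1 - q) ^ 2) + (1 - p) * Real.exp (-(0 - q) ^ 2)) := by ring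
    _ ≤ Real.exp (p * (1 - p) / 2) * Real.exp (-(p * (1 - p) / 2)) :=
        mul_le_mul_of_nonneg_left (hsum.trans he) (Real.exp_pos _).le
    _ = 1 := by rw [← Real.exp_add]; simp

/-- Converts an exponential moment bound on `a - b` into a comparison of expected square roots with
additive error at most one. -/
lemma sqrt_le_sqrt_add_exp {a b : ℝ} : √a ≤ √b + Real.exp (a - b) := by
  have he := Real.add_one_le_exp (a - b)
  have he0 := Real.exp_pos (a - b)
  by_cases h : a ≤ b
  · linarith [Real.sqrt_le_sqrt h]
  · push Not at h
    by_cases hb : 0 ≤ b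
    · refine Real.sqrt_le_iff.2 ⟨by positivity, ?_⟩
      nlinarith [Real.sq_sqrt hb, Real.sqrt_nonneg b]
    · rw [Real.sqrt_eq_zero_of_nonpos (not_le.1 hb).le, zero_add]
      refine Real.sqrt_le_iff.2 ⟨he0.le, ?_⟩
      nlinarith

/-- Half the realized variance minus the square loss has exponential moment at most one, for any
nature and forecaster. The constants round up `36/7` and `10/7`, from `7/10 ≤ 1/√2` and `18/5 =
(5/18)⁻¹`. -/
theorem expSqrtVar_le_err (T : ℕ) (P : Nature) (A : Forecaster) :
    expSqrtVar T P ≤ 6 * err (T := T) stepCEsub P A + 2 := by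
  let U : (n : ℕ) → Transcript n → Bool × I → ℝ := fun n h z =>
    bernVar z.2 / 2 - (bit z.1 - (A.predict n (outcomes h) z.2 : ℝ)) ^ 2
  have hUm (n : ℕ) : Measurable fun q : Transcript n × (Bool × I) => U n q.1 q.2 := by
    have hA : Measurable fun q : (Fin n → Bool) × I => A.predict n q.1 q.2 :=
      measurable_from_prod_countable_right fun x => A.measurable_predict n x
    have hA' : Measurable fun q : Transcript n × (Bool × I) =>
        (A.predict n (outcomes q.1) q.2.2 : ℝ) :=
      measurable_subtype_coe.comp (hA.comp ((measurable_outcomes.comp measurable_fst).prodMk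
        (measurable_snd.comp measurable_snd)))
    exact ((measurable_bernVar.comp (measurable_snd.comp measurable_snd)).div_const 2).sub
      (((measurable_bit.comp (measurable_fst.comp measurable_snd)).sub hA').pow_const 2)
  let Q : Transcript T → ℝ := fun ω =>
    ∑ t, (bit (outcomes ω t) - (A.predictions ω t : ℝ)) ^ 2
  let W : Transcript T → ℝ := fun ω => ∑ t : Fin T, U t (pre ω t) (ω t)
  have hWm : Measurable W := Finset.measurable_sum _ fun t _ =>
    (hUm t).comp ((measurable_pre t).prodMk (measurable_pi_apply t))
  have hW (ω : Transcript T) : W ω = realizedVar ω / 2 - Q ω := by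
    simp only [W, U, Q, realizedVar_eq, Finset.sum_sub_distrib, Finset.sum_div]
    rfl
  obtain ⟨hWi, hW1⟩ := integrable_exp_of_lintegral_le_one (μ := law P T) hWm
    (lintegral_exp_sum_le_one P U hUm T fun n _ h => by
      have hm : Measurable fun z => U n h z := (hUm n).comp measurable_prodMk_left
      refine lintegral_roundLaw_exp_le_one _ hm fun p => ?_
      have hq := A.predict n (outcomes h) p |>.2
      exact bernoulli_exp_sq_loss_le_one p.2.1 p.2.2 hq.1 hq.2)
  have hV := integrable_sqrt_realizedVar P T
  have hpt (ω : Transcript T) : 7 / 10 * √(realizedVar ω) ≤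
      18 / 5 * stepCEsub (outcomes ω) (A.predictions ω) + Real.exp (W ω) := by
    have h1 := sqrt_le_sqrt_add_exp (a := realizedVar ω / 2) (b := Q ω)
    rw [← hW] at h1
    have h2 : 7 / 10 * √(realizedVar ω) ≤ √(realizedVar ω / 2) := by
      refine Real.le_sqrt_of_sq_le ?_
      rw [mul_pow, Real.sq_sqrt (realizedVar_nonneg ω)]
      linarith [realizedVar_nonneg ω]
    have h3 := sqrt_le_stepCEsub (outcomes ω) (A.predictions ω)
    simp only [Q] at h1
    linarith
  have hS := integrable_stepCEsub (T := T) P A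
  have := integral_mono (hV.const_mul (7 / 10)) ((hS.const_mul (18 / 5)).add hWi) hpt
  rw [integral_const_mul, integral_add' (hS.const_mul _) hWi, integral_const_mul] at this
  change 7 / 10 * expSqrtVar T P ≤ 18 / 5 * err stepCEsub P A + _ at this
  have h0 : 0 ≤ err (T := T) stepCEsub P A := integral_nonneg fun ω =>
    div_nonneg (Finset.sum_nonneg fun S _ => stepCEOn_nonneg S _ _) (by positivity)
  linarith

lemma expSqrtVar_le_OPT (T : ℕ) (P : Nature) :
    expSqrtVar T P ≤ 6 * OPT (T := T) stepCEsub P + 2 := by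
  have : Nonempty Forecaster := ⟨truthful⟩
  have h : (expSqrtVar T P - 2) / 6 ≤ OPT (T := T) stepCEsub P :=
    le_ciInf fun A => by linarith [expSqrtVar_le_err T P A]
  linarith

/-! ### Asymptotic bounds -/

lemma log_T_bounds {T : ℕ} (hT : 2 ≤ T) {c : ℝ} (hc : 0 < c) (hc1 : c ≤ 1) :
    2 / 3 ≤ Real.log T ∧ Real.log T ≤ Real.log (T / c) ∧
      √(Real.log (1 / c)) ^ 2 = Real.log (T / c) - Real.log T := by
  have hT0 : (0 : ℝ) < T := by positivity
  have h1 : Real.log (T / c) = Real.log T + Real.log (1 / c) := by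
    rw [← Real.log_mul hT0.ne' (by positivity)]; congr 1; ring
  have h2 : 0 ≤ Real.log (1 / c) := Real.log_nonneg (by rw [le_div_iff₀ hc]; linarith)
  refine ⟨?_, by linarith, by rw [Real.sq_sqrt h2]; linarith⟩
  have h3 : Real.log 2 ≤ Real.log T := Real.log_le_log two_pos (by exact_mod_cast hT)
  linarith [Real.log_two_gt_d9]

theorem err_truthful_le_log {T : ℕ} {c : ℝ} {P : Nature} (hT : 2 ≤ T) (hc : 0 < c) (hc1 : c ≤ 1)
    (hP : IsSmoothed T c P) :
    err (T := T) stepCEsub P truthful ≤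
      1161 * (√(Real.log (1 / c)) + 1) * expSqrtVar T P
        + 1161 * (Real.log T ^ 2 * Real.log (T / c)) := by
  refine (err_truthful_le hT hc hc1 hP).trans ?_
  obtain ⟨hl, hlm, hs2⟩ := log_T_bounds hT hc hc1
  rw [Real.sqrt_mul zero_le_two]
  have hlogb (x : ℝ) (hx : 0 ≤ Real.log x) : 0 ≤ Real.logb 2 x ∧
      Real.logb 2 x ≤ 3 / 2 * Real.log x := by
    have h2 := Real.log_two_gt_d9
    have h2' : 0 < Real.log 2 := by linarith
    rw [Real.logb]
    refine ⟨by positivity, ?_⟩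
    rw [div_le_iff₀ h2']
    nlinarith
  obtain ⟨hL0, hL⟩ := hlogb T (by linarith)
  obtain ⟨hM0, hM⟩ := hlogb (T / c) (by linarith)
  have hs0 : 0 ≤ √(Real.log (1 / c)) := Real.sqrt_nonneg _
  have hV := expSqrtVar_nonneg T P
  set l := Real.log T
  set m := Real.log (T / c)
  set s := √(Real.log (1 / c))
  set V := expSqrtVar T P
  have hsV : 0 ≤ s * V := by positivity
  have hm : 2 / 3 ≤ m := by linarith
  have hl0 : 0 ≤ l := by linarith
  have hm0 : 0 ≤ m := by linarith
  have hlm1 : 4 / 9 ≤ l * m := by nlinarith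
  have hl2m : 8 / 27 ≤ l ^ 2 * m := by nlinarith
  have hll : 4 / 9 ≤ l ^ 2 := by nlinarith
  have hl2m' : 4 / 9 * m ≤ l ^ 2 * m := mul_le_mul_of_nonneg_right hll hm0
  have h1 : Real.logb 2 T * Real.logb 2 (T / c) ≤ (3 / 2 * l) * (3 / 2 * m) :=
    mul_le_mul hL hM hM0 (by positivity)
  have h2 : (Real.logb 2 T + 3) * (16 * Real.logb 2 T * Real.logb 2 (T / c) + 15) ≤
      (6 * l) * (70 * (l * m)) :=
    mul_le_mul (by linarith) (by linarith) (by positivity) (by positivity)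
  have hsqrt2 : √2 ≤ 3 / 2 := Real.sqrt_le_iff.2 ⟨by norm_num, by norm_num⟩
  have h3 : √2 * s ≤ 3 / 2 * s := mul_le_mul_of_nonneg_right hsqrt2 hs0
  have h4 : s ≤ (1 + m) / 2 := by nlinarith [sq_nonneg (s - 1)]
  linarith

theorem isTruthfulSmoothed_stepCEsub {T : ℕ} {c : ℝ} (hT : 2 ≤ T) (hc : 0 < c) (hc1 : c ≤ 1) :
    IsTruthfulSmoothed (T := T) stepCEsub c (20000 * (√(Real.log (1 / c)) + 1))
      (20000 * Real.log (T / c) ^ 3) := by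
  intro P hP
  refine (err_truthful_le_log hT hc hc1 hP).trans ?_
  obtain ⟨hl, hlm, hs2⟩ := log_T_bounds hT hc hc1
  have hO := expSqrtVar_le_OPT T P
  have hO0 : 0 ≤ OPT (T := T) stepCEsub P := Real.iInf_nonneg fun A => integral_nonneg fun ω =>
    div_nonneg (Finset.sum_nonneg fun S _ => stepCEOn_nonneg S _ _) (by positivity)
  have hs0 : 0 ≤ √(Real.log (1 / c)) := Real.sqrt_nonneg _
  set l := Real.log T
  set m := Real.log (T / c)
  set s := √(Real.log (1 / c))
  have hm : 2 / 3 ≤ m := by linarith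
  have hm0 : 0 ≤ m := by linarith
  have hmm : 4 / 9 ≤ m ^ 2 := by nlinarith
  have hm3 : 4 / 9 * m ≤ m ^ 3 := by nlinarith
  -- Everything additive is absorbed into `m ^ 3`: `m` is bounded below because `T ≥ 2`, and the
  -- term `s` left over from `hO` is at most `(1 + m) / 2`.
  have hll : l ^ 2 ≤ m ^ 2 := pow_le_pow_left₀ (by linarith) hlm 2
  have h1 : l ^ 2 * m ≤ m ^ 3 := by nlinarith
  have h2 := mul_le_mul_of_nonneg_left hO (by positivity : 0 ≤ 1161 * (s + 1))
  have h3 : 2 * s ≤ 1 + m := by nlinarith [sq_nonneg (s - 1)]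
  have h4 : 0 ≤ (s + 1) * OPT (T := T) stepCEsub P := by positivity
  linarith

end

end StepCalibration

theorem mainTheorem1 :
    -- the bound with explicit constants
    (∀ T : ℕ, 2 ≤ T → ∀ c : ℝ, 0 < c → c ≤ 1 →
      ∀ P : StepCalibration.Nature, StepCalibration.IsSmoothed T c P →
        StepCalibration.err (T := T) StepCalibration.stepCEsub P StepCalibration.truthful ≤
          (547 * √(Real.log (1 / c)) + 1161) * StepCalibration.expSqrtVar T P
            + (Real.logb 2 T + 3) * (16 * Real.logb 2 T * Real.logb 2 (T / c) + 15)
            + 8 * √(2 * Real.log (1 / c)) + 17 * √2) ∧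
    -- the asymptotic bound
    (∃ C : ℝ, 0 < C ∧ ∀ T : ℕ, 2 ≤ T → ∀ c : ℝ, 0 < c → c ≤ 1 →
      ∀ P : StepCalibration.Nature, StepCalibration.IsSmoothed T c P →
        StepCalibration.err (T := T) StepCalibration.stepCEsub P StepCalibration.truthful ≤
          C * (√(Real.log (1 / c)) + 1) * StepCalibration.expSqrtVar T P
            + C * (Real.log T ^ 2 * Real.log (T / c))) ∧
    -- truthfulness
    (∃ C : ℝ, 0 < C ∧ ∃ k : ℕ, ∀ T : ℕ, 2 ≤ T → ∀ c : ℝ, 0 < c → c ≤ 1 →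
      StepCalibration.IsTruthfulSmoothed (T := T) StepCalibration.stepCEsub c
        (C * (√(Real.log (1 / c)) + 1)) (C * Real.log (T / c) ^ k)) := by
  refine ⟨fun T hT c hc hc1 P hP => StepCalibration.err_truthful_le hT hc hc1 hP,
    ⟨1161, by norm_num, fun T hT c hc hc1 P hP =>
      StepCalibration.err_truthful_le_log hT hc hc1 hP⟩,
    ⟨20000, by norm_num, 3, fun T hT c hc hc1 =>
      StepCalibration.isTruthfulSmoothed_stepCEsub hT hc hc1⟩⟩
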